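/- Linearizability of the lazy-list concurrent set under its linearization points. **The object.** Consider the lazy-list implementation of a set of integers (Heller et al.). A node has a value in $\mathbb Z\cup\{-\infty,+\infty\}$, a reference $next$, a Boolean $marked$ and a lock. Initially the list is $Head\to Tail$, with values $-\infty$ and $+\infty$, both nodes unmarked and unlocked. Threads run $Add(key)$, $Remove(key)$ and $Contains(key)$, $key\in\mathbb Z$, asynchronously; each thread runs one method at a time. Every access to shared memory (read, write, node creation, lock acquisition or release) is one atomic event. * $Locate(key)$: set $n_1\gets Head$, $n_2\gets n_1.next$; while $n_2.val<key$, set $n_1\gets n_2$, $n_2\gets n_2.next$; lock $n_1$, then $n_2$; check one after the other that $n_1$ is unmarked, $n_2$ is unmarked, and $n_1.next=n_2$. If a check fails, release both locks and start again. * $Add(key)$: run $Locate$; if $n_2.val\ne key$, create a new node $n_3$ with value $key$, write $n_3.next\gets n_2$, write $n_1.next\gets n_3$, and the result is $true$; otherwise the result is $false$. Release both locks and return the result. * $Remove(key)$: run $Locate$; if $n_2.val=key$, write $n_2.marked\gets true$, write $n_1.next\gets n_2.next$, and the result is $true$; otherwise the result is $false$. Release both locks and return the result. * $Contains(key)$: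 set $n\gets Head$; while $n.val<key$, set $n\gets n.next$; return $false$ if $n.val\ne key$, or else if $n.marked$ is read as $true$; return $true$ otherwise. An execution is a finite sequence of events (invocations, responses, atomic events) starting in the initial state; its history is its subsequence of invocations and responses. The abstract set $S.AbS$ of a state $S$ is the set of integers that are values of unmarked nodes reachable from $Head$ through $next$. The sequential specification is that of a set, initially empty: $Add(k)$ returns whether $k$ was absent and inserts $k$; $Remove(k)$ returns whether $k$ was present and deletes $k$; $Contains(k)$ returns whether $k$ is present. **Linearization points (LPs).** * $Add(key,true)$: the write $n_1.next\gets n_3$. * $Add(key,false)$ and $Remove(key,false)$: the read of $n_2.val$ after $Locate$. * $Remove(key,true)$: the write $n_2.marked\gets true$. * $Contains(key,true)$: the read of $n.marked$. * $Contains(key,false)$: let $e$ be the read in the final test that makes it fail (it reads $n.val\ne key$, or $n.marked=true$). If the write $n_1.next\gets n_3$ of some $Add$ of the same key is executed between the invocation of this $Contains$ and $e$, the LP is a dummy event, which changes nothing, inserted just before the last such write; otherwise the LP is $e$. Complete a history by adding the response $true$ to each pending method that has executed an LP which changed the abstract set, in the order of these LPs, and by discarding the other pending methods. **Claim.** Let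 $E$ be an execution of the lazy list and $H$ its history. 1. Each method of the completed history has exactly one LP in $E$, and it lies between the invocation and the response of the method. 2. (Lazy-list Specific Equivalence.) Let $F$ be any execution of the lazy list whose history is sequential, $m_x$ a method of the completed history of $E$, and $m_y$ a method of $F$ that has responded, with the same invocation (method name and key). If the abstract set just before the LP of $m_x$ in $E$ equals the abstract set just before the invocation of $m_y$ in $F$, then $m_x$ and $m_y$ have the same response, and the abstract set just after the LP of $m_x$ equals the abstract set just after the response of $m_y$. 3. $H$ is linearizable. More precisely, there is a sequential history with exactly the events of the completed history, whose methods are ordered by their LPs in $E$ (methods linearized at dummy events before the same write may come in any order relative to each other), which respects the real-time order of $H$ and satisfies the sequential specification. -/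

import Mathlib

/-! The lazy-list concurrent set as a shared-memory transition system, its executions and
histories, linearizability, and the linearization points (LPs) of its methods. -/

namespace LazyList

universe u

/-- The three methods exported by the set. -/
inductive Op
  | add
  | remove
  | contains
  deriving DecidableEq

/-- A method instance: `thread` calls `op(key)`. The name `id` keeps apart several calls with the
same thread and parameters. -/
structure Call (T : Type u) where
  id : ℕ
  thread : T
  op : Op
  key : ℤ

/-- Node values: integers together with `-∞` (`⊥`, the head) and `+∞` (`⊤`, the tail). -/
abbrev Val := WithBot (WithTop ℤ)

/-- The node value that corresponds to a key. -/
def Val.ofKey (k : ℤ) : Val := ((k : WithTop ℤ) : Val)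

/-- A list node. Nodes are referred to by addresses in `ℕ`; `next = none` is the null reference;
`lock = some t` says that thread `t` holds the lock of the node. -/
structure Node (T : Type u) where
  val : Val
  next : Option ℕ
  marked : Bool
  lock : Option T

/-- The shared memory; `none` at the addresses where no node has been created. -/
abbrev Heap (T : Type u) := ℕ → Option (Node T)

/-- The address of the sentinel `Head`. -/
def head : ℕ := 0

/-- The address of the sentinel `Tail`. -/
def tail : ℕ := 1

/-- The initial memory: `Head -> Tail`, both unmarked and unlocked, and no other node. -/
def initialHeap (T : Type u) : Heap T := fun a =>
  if a = head then some ⟨⊥, some tail, false, none⟩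
  else if a = tail then some ⟨⊤, none, false, none⟩
  else none

/-- The atomic statements of the methods, each with the current values of the local variables that
are still needed. Every access to the shared memory is a statement of its own; assignments to local
variables and branching are attached to the access that precedes them. -/
inductive Instr
  -- Locate (used by Add and Remove)
  /-- `n₁ ← read(Head)` -/
  | locHead
  /-- `n₂ ← read(n₁.next)` -/
  | locFirst (n₁ : ℕ)
  /-- `while read(n₂.val) < key` -/
  | locTest (n₁ n₂ : ℕ)
  /-- `n₁ ← n₂; n₂ ← read(n₂.next)` -/
  | locAdvance (n₁ n₂ : ℕ)
  /-- `lock.acquire(n₁)` -/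
  | acquire₁ (n₁ n₂ : ℕ)
  /-- `lock.acquire(n₂)` -/
  | acquire₂ (n₁ n₂ : ℕ)
  -- Validate
  /-- `read(n₁.marked) = false` -/
  | validate₁ (n₁ n₂ : ℕ)
  /-- `read(n₂.marked) = false` -/
  | validate₂ (n₁ n₂ : ℕ)
  /-- `read(n₁.next) = n₂` -/
  | validate₃ (n₁ n₂ : ℕ)
  /-- `lock.release(n₁)` after a failed validation -/
  | retry₁ (n₁ n₂ : ℕ)
  /-- `lock.release(n₂)` after a failed validation -/
  | retry₂ (n₁ n₂ : ℕ)
  -- Add and Remove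
  /-- `if read(n₂.val) ≠ key` in Add, `if read(n₂.val) = key` in Remove -/
  | check (n₁ n₂ : ℕ)
  /-- Add: `write(n₃, new node(key))` -/
  | newNode (n₁ n₂ : ℕ)
  /-- Add: `write(n₃.next, n₂)` -/
  | linkNew (n₁ n₂ n₃ : ℕ)
  /-- Add: `write(n₁.next, n₃)` -/
  | insert (n₁ n₂ n₃ : ℕ)
  /-- Remove: `write(n₂.marked, true)` -/
  | mark (n₁ n₂ : ℕ)
  /-- Remove: the read of `n₂.next` in `write(n₁.next, n₂.next)` -/
  | readSucc (n₁ n₂ : ℕ)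
  /-- Remove: the write of the value `m` just read in `write(n₁.next, n₂.next)` -/
  | unlink (n₁ n₂ : ℕ) (m : Option ℕ)
  /-- `lock.release(n₁)`, with the value of `flag` to be returned -/
  | release₁ (n₁ n₂ : ℕ) (flag : Bool)
  /-- `lock.release(n₂)`, with the value of `flag` to be returned -/
  | release₂ (n₁ n₂ : ℕ) (flag : Bool)
  -- Contains
  /-- `n ← read(Head)` -/
  | conHead
  /-- `while read(n.val) < key` -/
  | conTest (n : ℕ)
  /-- `n ← read(n.next)` -/
  | conNext (n : ℕ)
  /-- `read(n.val) ≠ key` in the final condition -/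
  | conVal (n : ℕ)
  /-- `read(n.marked)` in the final condition -/
  | conMark (n : ℕ)
  /-- `return flag` -/
  | ret (flag : Bool)

/-- The first statement of a method. -/
def Op.entry : Op → Instr
  | .add => .locHead
  | .remove => .locHead
  | .contains => .conHead

/-- Store the node `x` at address `a`. -/
def Heap.set {T : Type u} (h : Heap T) (a : ℕ) (x : Node T) : Heap T := Function.update h a (some x)

/-- `MemStep c h s h' s'`: executing the atomic statement `s` of the call `c` in the memory `h`
may lead to the memory `h'`, with `s'` the next statement of `c`. There is no step for
acquiring a lock that is held, nor for dereferencing null. -/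
inductive MemStep {T : Type u} (c : Call T) : Heap T → Instr → Heap T → Instr → Prop
  | locHead (h : Heap T) : MemStep c h .locHead h (.locFirst head)
  | locFirst (h : Heap T) (n₁ n₂ : ℕ) (x : Node T) (hx : h n₁ = some x) (hn : x.next = some n₂) :
      MemStep c h (.locFirst n₁) h (.locTest n₁ n₂)
  | locTest_lt (h : Heap T) (n₁ n₂ : ℕ) (y : Node T) (hy : h n₂ = some y)
      (hv : y.val < Val.ofKey c.key) : MemStep c h (.locTest n₁ n₂) h (.locAdvance n₁ n₂)
  | locTest_ge (h : Heap T) (n₁ n₂ : ℕ) (y : Node T) (hy : h n₂ = some y)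
      (hv : ¬ y.val < Val.ofKey c.key) : MemStep c h (.locTest n₁ n₂) h (.acquire₁ n₁ n₂)
  | locAdvance (h : Heap T) (n₁ n₂ m : ℕ) (y : Node T) (hy : h n₂ = some y)
      (hn : y.next = some m) : MemStep c h (.locAdvance n₁ n₂) h (.locTest n₂ m)
  | acquire₁ (h : Heap T) (n₁ n₂ : ℕ) (x : Node T) (hx : h n₁ = some x) (hl : x.lock = none) :
      MemStep c h (.acquire₁ n₁ n₂) (h.set n₁ { x with lock := some c.thread }) (.acquire₂ n₁ n₂)
  | acquire₂ (h : Heap T) (n₁ n₂ : ℕ) (y : Node T) (hy : h n₂ = some y) (hl : y.lock = none) :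
      MemStep c h (.acquire₂ n₁ n₂) (h.set n₂ { y with lock := some c.thread }) (.validate₁ n₁ n₂)
  | validate₁_ok (h : Heap T) (n₁ n₂ : ℕ) (x : Node T) (hx : h n₁ = some x)
      (hm : x.marked = false) : MemStep c h (.validate₁ n₁ n₂) h (.validate₂ n₁ n₂)
  | validate₁_fail (h : Heap T) (n₁ n₂ : ℕ) (x : Node T) (hx : h n₁ = some x)
      (hm : x.marked = true) : MemStep c h (.validate₁ n₁ n₂) h (.retry₁ n₁ n₂)
  | validate₂_ok (h : Heap T) (n₁ n₂ : ℕ) (y : Node T) (hy : h n₂ = some y)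
      (hm : y.marked = false) : MemStep c h (.validate₂ n₁ n₂) h (.validate₃ n₁ n₂)
  | validate₂_fail (h : Heap T) (n₁ n₂ : ℕ) (y : Node T) (hy : h n₂ = some y)
      (hm : y.marked = true) : MemStep c h (.validate₂ n₁ n₂) h (.retry₁ n₁ n₂)
  | validate₃_ok (h : Heap T) (n₁ n₂ : ℕ) (x : Node T) (hx : h n₁ = some x)
      (hn : x.next = some n₂) : MemStep c h (.validate₃ n₁ n₂) h (.check n₁ n₂)
  | validate₃_fail (h : Heap T) (n₁ n₂ : ℕ) (x : Node T) (hx : h n₁ = some x)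
      (hn : x.next ≠ some n₂) : MemStep c h (.validate₃ n₁ n₂) h (.retry₁ n₁ n₂)
  | retry₁ (h : Heap T) (n₁ n₂ : ℕ) (x : Node T) (hx : h n₁ = some x) :
      MemStep c h (.retry₁ n₁ n₂) (h.set n₁ { x with lock := none }) (.retry₂ n₁ n₂)
  | retry₂ (h : Heap T) (n₁ n₂ : ℕ) (y : Node T) (hy : h n₂ = some y) :
      MemStep c h (.retry₂ n₁ n₂) (h.set n₂ { y with lock := none }) .locHead
  | check_add_ne (h : Heap T) (n₁ n₂ : ℕ) (y : Node T) (hy : h n₂ = some y) (ho : c.op = .add)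
      (hv : y.val ≠ Val.ofKey c.key) : MemStep c h (.check n₁ n₂) h (.newNode n₁ n₂)
  | check_add_eq (h : Heap T) (n₁ n₂ : ℕ) (y : Node T) (hy : h n₂ = some y) (ho : c.op = .add)
      (hv : y.val = Val.ofKey c.key) : MemStep c h (.check n₁ n₂) h (.release₁ n₁ n₂ false)
  | check_remove_eq (h : Heap T) (n₁ n₂ : ℕ) (y : Node T) (hy : h n₂ = some y)
      (ho : c.op = .remove) (hv : y.val = Val.ofKey c.key) :
      MemStep c h (.check n₁ n₂) h (.mark n₁ n₂)
  | check_remove_ne (h : Heap T) (n₁ n₂ : ℕ) (y : Node T) (hy : h n₂ = some y)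
      (ho : c.op = .remove) (hv : y.val ≠ Val.ofKey c.key) :
      MemStep c h (.check n₁ n₂) h (.release₁ n₁ n₂ false)
  | newNode (h : Heap T) (n₁ n₂ n₃ : ℕ) (hf : h n₃ = none) :
      MemStep c h (.newNode n₁ n₂) (h.set n₃ ⟨Val.ofKey c.key, none, false, none⟩)
        (.linkNew n₁ n₂ n₃)
  | linkNew (h : Heap T) (n₁ n₂ n₃ : ℕ) (z : Node T) (hz : h n₃ = some z) :
      MemStep c h (.linkNew n₁ n₂ n₃) (h.set n₃ { z with next := some n₂ }) (.insert n₁ n₂ n₃)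
  | insert (h : Heap T) (n₁ n₂ n₃ : ℕ) (x : Node T) (hx : h n₁ = some x) :
      MemStep c h (.insert n₁ n₂ n₃) (h.set n₁ { x with next := some n₃ }) (.release₁ n₁ n₂ true)
  | mark (h : Heap T) (n₁ n₂ : ℕ) (y : Node T) (hy : h n₂ = some y) :
      MemStep c h (.mark n₁ n₂) (h.set n₂ { y with marked := true }) (.readSucc n₁ n₂)
  | readSucc (h : Heap T) (n₁ n₂ : ℕ) (y : Node T) (hy : h n₂ = some y) :
      MemStep c h (.readSucc n₁ n₂) h (.unlink n₁ n₂ y.next)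
  | unlink (h : Heap T) (n₁ n₂ : ℕ) (m : Option ℕ) (x : Node T) (hx : h n₁ = some x) :
      MemStep c h (.unlink n₁ n₂ m) (h.set n₁ { x with next := m }) (.release₁ n₁ n₂ true)
  | release₁ (h : Heap T) (n₁ n₂ : ℕ) (flag : Bool) (x : Node T) (hx : h n₁ = some x) :
      MemStep c h (.release₁ n₁ n₂ flag) (h.set n₁ { x with lock := none }) (.release₂ n₁ n₂ flag)
  | release₂ (h : Heap T) (n₁ n₂ : ℕ) (flag : Bool) (y : Node T) (hy : h n₂ = some y) :
      MemStep c h (.release₂ n₁ n₂ flag) (h.set n₂ { y with lock := none }) (.ret flag)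
  | conHead (h : Heap T) : MemStep c h .conHead h (.conTest head)
  | conTest_lt (h : Heap T) (n : ℕ) (x : Node T) (hx : h n = some x)
      (hv : x.val < Val.ofKey c.key) : MemStep c h (.conTest n) h (.conNext n)
  | conTest_ge (h : Heap T) (n : ℕ) (x : Node T) (hx : h n = some x)
      (hv : ¬ x.val < Val.ofKey c.key) : MemStep c h (.conTest n) h (.conVal n)
  | conNext (h : Heap T) (n m : ℕ) (x : Node T) (hx : h n = some x) (hn : x.next = some m) :
      MemStep c h (.conNext n) h (.conTest m)
  | conVal_ne (h : Heap T) (n : ℕ) (x : Node T) (hx : h n = some x)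
      (hv : x.val ≠ Val.ofKey c.key) : MemStep c h (.conVal n) h (.ret false)
  | conVal_eq (h : Heap T) (n : ℕ) (x : Node T) (hx : h n = some x)
      (hv : x.val = Val.ofKey c.key) : MemStep c h (.conVal n) h (.conMark n)
  | conMark (h : Heap T) (n : ℕ) (x : Node T) (hx : h n = some x) :
      MemStep c h (.conMark n) h (.ret (!x.marked))

/-- A global state: the shared memory and, for each thread, the call it is executing (if any)
with the next statement of that call. -/
structure State (T : Type u) where
  heap : Heap T
  frame : T → Option (Call T × Instr)

/-- The initial global state: the empty list, all threads idle. -/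
def State.start (T : Type u) : State T := ⟨initialHeap T, fun _ => none⟩

/-- The atomic events: invocation of a call, execution of an atomic statement by a call, response
of a call with its return value. -/
inductive Event (T : Type u)
  | inv (c : Call T)
  | mem (c : Call T) (s : Instr)
  | rsp (c : Call T) (b : Bool)

/-- The effect of an event on the global state. A thread invokes a method only when it is idle. -/
inductive Step {T : Type u} [DecidableEq T] : State T → Event T → State T → Prop
  | inv (S : State T) (c : Call T) (hf : S.frame c.thread = none) :
      Step S (.inv c) ⟨S.heap, Function.update S.frame c.thread (some (c, c.op.entry))⟩
  | mem (S : State T) (c : Call T) (s s' : Instr) (h' : Heap T)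
      (hf : S.frame c.thread = some (c, s)) (hs : MemStep c S.heap s h' s') :
      Step S (.mem c s) ⟨h', Function.update S.frame c.thread (some (c, s'))⟩
  | rsp (S : State T) (c : Call T) (b : Bool) (hf : S.frame c.thread = some (c, .ret b)) :
      Step S (.rsp c b) ⟨S.heap, Function.update S.frame c.thread none⟩

/-- An execution of the lazy list: a finite sequence of `len` events `ev 0, ev 1, …` leading from
the initial state `st 0` through `st 1, st 2, …`. The values of `ev` from `len` on and of `st`
after `len` are irrelevant. Distinct invocation events belong to distinct method instances. -/
structure Execution (T : Type u) [DecidableEq T] where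
  len : ℕ
  st : ℕ → State T
  ev : ℕ → Event T
  st_zero : st 0 = State.start T
  step : ∀ i < len, Step (st i) (ev i) (st (i + 1))
  inv_unique : ∀ i < len, ∀ j < len, ∀ c, ev i = .inv c → ev j = .inv c → i = j

/-! ### The abstract set -/

/-- `a.next = b` -/
def Points {T : Type u} (h : Heap T) (a b : ℕ) : Prop := ∃ x, h a = some x ∧ x.next = some b

/-- The unmarked nodes that are reachable from `Head`. -/
def absNodes {T : Type u} (h : Heap T) : Set ℕ :=
  {n | Relation.ReflTransGen (Points h) head n ∧ ∃ x, h n = some x ∧ x.marked = false}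

/-- The abstract set `S.AbS` of a global state, with nodes identified by their keys (so that
different executions can be compared) and without the sentinels. -/
def State.abs {T : Type u} (S : State T) : Set ℤ :=
  {k | ∃ n ∈ absNodes S.heap, ∃ x, S.heap n = some x ∧ x.val = Val.ofKey k}

/-! ### Histories and linearizability -/

/-- The events of a history. -/
inductive HEvent (T : Type u)
  | inv (c : Call T)
  | rsp (c : Call T) (b : Bool)

/-- The call to which an event of a history belongs. -/
def HEvent.call {T : Type u} : HEvent T → Call T
  | .inv c => c
  | .rsp c _ => c

/-- A history: a finite sequence of invocation and response events. -/
abbrev History (T : Type u) := List (HEvent T)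

/-- Invocation and response events, seen as events of a history. -/
def Event.toHEvent {T : Type u} : Event T → Option (HEvent T)
  | .inv c => some (.inv c)
  | .mem _ _ => none
  | .rsp c b => some (.rsp c b)

/-- The history of an execution: its subsequence of invocation and response events. -/
def Execution.history {T : Type u} [DecidableEq T] (E : Execution T) : History T :=
  (List.range E.len).filterMap fun i => (E.ev i).toHEvent

/-- A call is pending in a history if it was invoked and has no response. -/
def Pending {T : Type u} (H : History T) (c : Call T) : Prop :=
  .inv c ∈ H ∧ ∀ b, .rsp c b ∉ H

open Classical in
/-- Append to `H` the responses listed in `R` and discard the other pending invocations. -/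
noncomputable def History.completeBy {T : Type u} (H : History T) (R : List (Call T × Bool)) :
    History T :=
  H.filter (fun e => ¬ Pending H e.call ∨ e.call ∈ R.map Prod.fst) ++
    R.map fun p => .rsp p.1 p.2

/-- `H'` is a completion of `H`: some pending calls get a response, the other pending calls are
discarded. -/
def IsCompletion {T : Type u} (H H' : History T) : Prop :=
  ∃ R : List (Call T × Bool), (R.map Prod.fst).Nodup ∧ (∀ p ∈ R, Pending H p.1) ∧
    H' = H.completeBy R

/-- Every invocation, except possibly the last, is immediately followed by its response. -/
inductive Sequential {T : Type u} : History T → Prop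
  | nil : Sequential []
  | pending (c : Call T) : Sequential [.inv c]
  | cons (c : Call T) (b : Bool) (H : History T) (hH : Sequential H) :
      Sequential (.inv c :: .rsp c b :: H)

/-- The real-time order of a history: the response of `c` precedes the invocation of `c'`. -/
def RealTime {T : Type u} (H : History T) (c c' : Call T) : Prop :=
  ∃ (i j : ℕ) (b : Bool), i < j ∧ H[i]? = some (.rsp c b) ∧ H[j]? = some (.inv c')

/-- The sequential specification of a set, one method at a time: `Spec op k A b A'` says that
`op(k)` in the abstract state `A` returns `b` and leads to the abstract state `A'`. -/
inductive Spec : Op → ℤ → Set ℤ → Bool → Set ℤ → Prop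
  | add_true (k : ℤ) (A : Set ℤ) (hk : k ∉ A) : Spec .add k A true (insert k A)
  | add_false (k : ℤ) (A : Set ℤ) (hk : k ∈ A) : Spec .add k A false A
  | remove_true (k : ℤ) (A : Set ℤ) (hk : k ∈ A) : Spec .remove k A true (A \ {k})
  | remove_false (k : ℤ) (A : Set ℤ) (hk : k ∉ A) : Spec .remove k A false A
  | contains_true (k : ℤ) (A : Set ℤ) (hk : k ∈ A) : Spec .contains k A true A
  | contains_false (k : ℤ) (A : Set ℤ) (hk : k ∉ A) : Spec .contains k A false A

/-- The sequential histories allowed by the specification from the abstract state `A` on. -/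
inductive LegalFrom {T : Type u} : Set ℤ → History T → Prop
  | nil (A : Set ℤ) : LegalFrom A []
  | pending (A : Set ℤ) (c : Call T) : LegalFrom A [.inv c]
  | cons (A A' : Set ℤ) (c : Call T) (b : Bool) (H : History T) (hc : Spec c.op c.key A b A')
      (hH : LegalFrom A' H) : LegalFrom A (.inv c :: .rsp c b :: H)

/-- A sequential history is legal if it satisfies the specification from the empty set on. -/
def Legal {T : Type u} (S : History T) : Prop := LegalFrom ∅ S

/-- `S` is a linearization of `H` through the completion `H'`. No event occurs twice in a
history, so `List.Perm` says that `S` and `H'` have the same events. The real-time order of `H` has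
to be kept for the calls that the completion does not discard. -/
structure IsLinearization {T : Type u} (H H' S : History T) : Prop where
  completion : IsCompletion H H'
  sequential : Sequential S
  equivalent : S.Perm H'
  realTime : ∀ c c', .inv c ∈ H' → .inv c' ∈ H' → RealTime H c c' → RealTime S c c'
  legal : Legal S

/-- Linearizability of a history. -/
def Linearizable {T : Type u} (H : History T) : Prop := ∃ H' S, IsLinearization H H' S

/-! ### The linearization points -/

/-- The event number `i` of the execution `E` is `e`. -/
def Execution.At {T : Type u} [DecidableEq T] (E : Execution T) (i : ℕ) (e : Event T) : Prop :=
  i < E.len ∧ E.ev i = e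

/-- A point of an execution: the event number `i`, or a dummy event inserted just before the event
number `i`. -/
inductive Point
  | event (i : ℕ)
  | dummy (i : ℕ)

/-- The position of a point among all events and dummy events. -/
def Point.rank : Point → ℕ
  | .event i => 2 * i + 1
  | .dummy i => 2 * i

/-- The abstract set just before a point. -/
def Execution.absPre {T : Type u} [DecidableEq T] (E : Execution T) : Point → Set ℤ
  | .event i => (E.st i).abs
  | .dummy i => (E.st i).abs

/-- The abstract set just after a point. A dummy event changes nothing. -/
def Execution.absPost {T : Type u} [DecidableEq T] (E : Execution T) : Point → Set ℤ
  | .event i => (E.st (i + 1)).abs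
  | .dummy i => (E.st i).abs

/-- The event number `j` is the read in the final condition of the Contains call `c` that makes it
return `false`: it reads `n.val ≠ key`, or it reads `n.marked = true`. -/
def FailingRead {T : Type u} [DecidableEq T] (E : Execution T) (c : Call T) (j : ℕ) : Prop :=
  ∃ n x, (E.st j).heap n = some x ∧
    ((E.At j (.mem c (.conVal n)) ∧ x.val ≠ Val.ofKey c.key) ∨
      (E.At j (.mem c (.conMark n)) ∧ x.marked = true))

/-- The event number `i` is the `write(n₁.next, n₃)` of an Add of the key of `c`, executed after the
invocation of `c` and before the event number `j`. -/
def ConcurrentAdd {T : Type u} [DecidableEq T] (E : Execution T) (c : Call T) (j i : ℕ) : Prop :=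
  (∃ a < i, E.At a (.inv c)) ∧ i < j ∧
    ∃ c' n₁ n₂ n₃, E.At i (.mem c' (.insert n₁ n₂ n₃)) ∧ c'.key = c.key

/-- The linearization points of a Contains call that returns `false`: the read that makes it fail
if no Add of the same key took effect during the call before that read, and otherwise a dummy event
just before the `write(n₁.next, n₃)` of the last such Add. -/
def IsContainsFalseLP {T : Type u} [DecidableEq T] (E : Execution T) (c : Call T) (p : Point) :
    Prop :=
  ∃ j, FailingRead E c j ∧
    (((∀ i, ¬ ConcurrentAdd E c j i) ∧ p = .event j) ∨
      ∃ i, ConcurrentAdd E c j i ∧ (∀ i', ConcurrentAdd E c j i' → i' ≤ i) ∧ p = .dummy i)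

/-- `p` is a linearization point of the call `c` with return value `b`. -/
def IsLP {T : Type u} [DecidableEq T] (E : Execution T) (c : Call T) (b : Bool) (p : Point) :
    Prop :=
  match c.op, b with
  | .add, true => ∃ i n₁ n₂ n₃, E.At i (.mem c (.insert n₁ n₂ n₃)) ∧ p = .event i
  | .add, false => ∃ i n₁ n₂, E.At i (.mem c (.check n₁ n₂)) ∧ p = .event i
  | .remove, true => ∃ i n₁ n₂, E.At i (.mem c (.mark n₁ n₂)) ∧ p = .event i
  | .remove, false => ∃ i n₁ n₂, E.At i (.mem c (.check n₁ n₂)) ∧ p = .event i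
  | .contains, true => ∃ i n, E.At i (.mem c (.conMark n)) ∧ p = .event i
  | .contains, false => IsContainsFalseLP E c p

/-- A pending call that has executed a linearization point which changed the abstract set (such a
call is going to return `true`). -/
def PendingEffective {T : Type u} [DecidableEq T] (E : Execution T) (c : Call T) : Prop :=
  Pending E.history c ∧ ∃ p, IsLP E c true p ∧ E.absPre p ≠ E.absPost p

/-- The calls, with their return values, of the completed history of `E`: the pending calls that
have changed the abstract set return `true`, the other pending calls are ignored. -/
def Returns {T : Type u} [DecidableEq T] (E : Execution T) (c : Call T) (b : Bool) : Prop :=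
  .rsp c b ∈ E.history ∨ (PendingEffective E c ∧ b = true)

/-- The point `p` lies between the invocation and the response (if there is one) of `c`. -/
def Within {T : Type u} [DecidableEq T] (E : Execution T) (c : Call T) (p : Point) : Prop :=
  (∃ a, E.At a (.inv c) ∧ (Point.event a).rank < p.rank) ∧
    ∀ r b, E.At r (.rsp c b) → p.rank < (Point.event r).rank

/-- Each call of the completed history has exactly one linearization point, and it lies between
the invocation and the response of the call. -/
def HasLPs {T : Type u} [DecidableEq T] (E : Execution T) : Prop :=
  ∀ c b, Returns E c b → (∃! p, IsLP E c b p) ∧ ∀ p, IsLP E c b p → Within E c p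

/-- Specific Equivalence of an execution `E` and a sequential execution `F`: if the abstract set
just before the linearization point of a method in `E` equals the abstract set just before
the invocation of a method in `F`, and both are invoked with the same parameters, then they have the
same response, and the abstract sets just after the linearization point in `E` and just after
the response in `F` are equal. -/
def SpecificEquivalence {T : Type u} [DecidableEq T] (E F : Execution T) : Prop :=
  ∀ c b p, Returns E c b → IsLP E c b p →
    ∀ c' b' i j, F.At i (.inv c') → F.At j (.rsp c' b') →
      c.op = c'.op → c.key = c'.key → E.absPre p = (F.st i).abs →
        b = b' ∧ E.absPost p = (F.st (j + 1)).abs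

/-- The history of `E` is linearizable under the given linearization points: it has a
linearization `S`, through the completion that adds the response `true` exactly for the pending
calls that have changed the abstract set, in the order of their linearization points, such that
the methods in `S` are ordered by their linearization points. -/
def LinearizedByLPs {T : Type u} [DecidableEq T] (E : Execution T) : Prop :=
  ∃ (R : List (Call T × Bool)) (S : History T),
    IsLinearization E.history (E.history.completeBy R) S ∧
    (R.map Prod.fst).Nodup ∧
    (∀ c b, (c, b) ∈ R ↔ PendingEffective E c ∧ b = true) ∧
    R.Pairwise (fun x y => ∀ p q, IsLP E x.1 x.2 p → IsLP E y.1 y.2 q → p.rank < q.rank) ∧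
    ∀ c b p c' b' p', .rsp c b ∈ S → .rsp c' b' ∈ S → IsLP E c b p → IsLP E c' b' p' →
      RealTime S c c' → p.rank ≤ p'.rank

end LazyList

namespace LazyList

universe u

variable {T : Type u}

/-! ### Paths in the heap -/

/-! Let `P` be the set of nodes that have ever been linked into the list. The invariant (`HeapOK`)
says that values strictly increase along `next` inside `P`, even at removed nodes, and that every
unmarked node of `P` is reachable from `head`. Hence the abstract set is simply the set of keys of
unmarked nodes of `P` (`HeapOK.mem_abs_iff`), and reachability disappears from most arguments. Locks
make what a call has validated about its two nodes stable under steps of other threads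
(`MemStep.rely`, `FrameOK.rely`). If the first node of a validated window is unmarked and points to
a second node of another value, the key lies strictly between adjacent nodes and is absent
(`Window.notMem_abs`). So only the `insert` and `mark` statements change the abstract set, each as
the specification demands.

Each finished call has exactly one deciding step, at which its return value becomes fixed
(`Execution.Decides`). Except for Contains returning `false`, this step is the linearization point
and meets the specification there (`Execution.Decides.spec`).

For Contains returning `false`: just before an `insert` of the same key the key is absent, which
settles the dummy point. If there is no such `insert` during the call and the key were present at
the failing read, on a node `m`, then `m` would have been in the list and unmarked ever since the
invocation, because marks are never undone. The traversal could not have passed `m`, so it would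
have stopped there and found it unmarked (`FailingRead.notMem_abs`).

Finally, every change of the abstract set is the linearization point of a completed call. Sorting
the completed calls by linearization point therefore gives a legal sequential history, and real-time
order is respected because each point lies inside its call. Specific Equivalence follows because the
specification is deterministic, and because in a sequential execution the abstract set changes
during a call at most at its own point. -/

/-- `b` can be reached from `a` by following `next`. -/
abbrev Reach (h : Heap T) : ℕ → ℕ → Prop := Relation.ReflTransGen (Points h)

theorem Points.unique {h : Heap T} {a b b' : ℕ} (hb : Points h a b) (hb' : Points h a b') :
    b = b' := by
  obtain ⟨x, hx, hn⟩ := hb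
  obtain ⟨x', hx', hn'⟩ := hb'
  grind

theorem Reach.total {h : Heap T} {a b c : ℕ} (hb : Reach h a b) (hc : Reach h a c) :
    Reach h b c ∨ Reach h c b :=
  Relation.ReflTransGen.total_of_right_unique (fun _ _ _ => Points.unique) hb hc

theorem Reach.next {h : Heap T} {a b c : ℕ} (hc : Reach h a c) (hne : a ≠ c)
    (hb : Points h a b) : Reach h b c := by
  rcases Relation.ReflTransGen.cases_head hc with rfl | ⟨d, hd, hr⟩
  · exact absurd rfl hne
  · rwa [hb.unique hd]

theorem Heap.set_self (h : Heap T) (a : ℕ) (x : Node T) : h.set a x a = some x :=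
  Function.update_self ..

theorem Heap.set_of_ne (h : Heap T) {a b : ℕ} (x : Node T) (hb : b ≠ a) : h.set a x b = h b :=
  Function.update_of_ne hb ..

theorem Heap.set_apply (h : Heap T) (a b : ℕ) (x : Node T) :
    h.set a x b = if b = a then some x else h b := by
  split_ifs with hb
  · rw [hb, set_self]
  · exact h.set_of_ne x hb

/-! ### The invariant -/

/-- The memory `h` is well formed, where `P` is the set of the nodes that have been linked into
the list at some time. -/
structure HeapOK (P : Set ℕ) (h : Heap T) : Prop where
  head_mem : head ∈ P
  head_node : ∃ x, h head = some x ∧ x.val = ⊥ ∧ x.marked = false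
  alloc : ∀ a ∈ P, ∃ x, h a = some x
  -- Marked nodes are included, so a traversal standing on a removed node still moves to larger
  -- values inside `P`.
  next : ∀ a ∈ P, ∀ x b, h a = some x → x.next = some b →
    b ∈ P ∧ ∃ y, h b = some y ∧ x.val < y.val
  reach : ∀ a ∈ P, ∀ x, h a = some x → x.marked = false → Reach h head a

/-- The nodes `n₁` and `n₂`, with contents `x` and `y`, enclose the key of `c`. -/
structure Window (P : Set ℕ) (h : Heap T) (c : Call T) (n₁ n₂ : ℕ) (x y : Node T) : Prop where
  mem₁ : n₁ ∈ P
  mem₂ : n₂ ∈ P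
  get₁ : h n₁ = some x
  get₂ : h n₂ = some y
  lt : x.val < Val.ofKey c.key
  ge : ¬ y.val < Val.ofKey c.key

/-- A window both of whose nodes are locked by the thread of `c`. -/
structure Locked (P : Set ℕ) (h : Heap T) (c : Call T) (n₁ n₂ : ℕ) (x y : Node T) : Prop
    extends Window P h c n₁ n₂ x y where
  lock₁ : x.lock = some c.thread
  lock₂ : y.lock = some c.thread

/-- What the call `c` knows about the memory when `s` is its next statement. -/
def FrameOK (P : Set ℕ) (h : Heap T) (c : Call T) : Instr → Prop
  | .locHead => c.op ≠ .contains
  | .locFirst n₁ => c.op ≠ .contains ∧ n₁ = head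
  -- Of a node not locked by the call, only facts that no thread can destroy are recorded:
  -- membership in `P` and the value. Marks and `next` enter after the locks.
  | .locTest n₁ n₂ => c.op ≠ .contains ∧ n₁ ∈ P ∧ n₂ ∈ P ∧
      ∃ x, h n₁ = some x ∧ x.val < Val.ofKey c.key
  | .locAdvance _ n₂ => c.op ≠ .contains ∧ n₂ ∈ P ∧
      ∃ y, h n₂ = some y ∧ y.val < Val.ofKey c.key
  | .acquire₁ n₁ n₂ => c.op ≠ .contains ∧ ∃ x y, Window P h c n₁ n₂ x y
  | .acquire₂ n₁ n₂ => c.op ≠ .contains ∧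
      ∃ x y, Window P h c n₁ n₂ x y ∧ x.lock = some c.thread
  | .validate₁ n₁ n₂ => c.op ≠ .contains ∧ ∃ x y, Locked P h c n₁ n₂ x y
  | .validate₂ n₁ n₂ => c.op ≠ .contains ∧ ∃ x y, Locked P h c n₁ n₂ x y ∧ x.marked = false
  | .validate₃ n₁ n₂ => c.op ≠ .contains ∧
      ∃ x y, Locked P h c n₁ n₂ x y ∧ x.marked = false ∧ y.marked = false
  | .retry₁ n₁ n₂ => c.op ≠ .contains ∧ ∃ x y, Locked P h c n₁ n₂ x y
  | .retry₂ _ n₂ => c.op ≠ .contains ∧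
      n₂ ∈ P ∧ ∃ y, h n₂ = some y ∧ y.lock = some c.thread
  | .check n₁ n₂ => c.op ≠ .contains ∧
      ∃ x y, Locked P h c n₁ n₂ x y ∧ x.marked = false ∧ y.marked = false ∧ x.next = some n₂
  | .newNode n₁ n₂ => c.op = .add ∧
      ∃ x y, Locked P h c n₁ n₂ x y ∧ x.marked = false ∧ x.next = some n₂ ∧
        y.val ≠ Val.ofKey c.key
  | .linkNew n₁ n₂ n₃ => c.op = .add ∧ n₃ ∉ P ∧
      h n₃ = some ⟨Val.ofKey c.key, none, false, none⟩ ∧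
      ∃ x y, Locked P h c n₁ n₂ x y ∧ x.marked = false ∧ x.next = some n₂ ∧
        y.val ≠ Val.ofKey c.key
  | .insert n₁ n₂ n₃ => c.op = .add ∧ n₃ ∉ P ∧
      h n₃ = some ⟨Val.ofKey c.key, some n₂, false, none⟩ ∧
      ∃ x y, Locked P h c n₁ n₂ x y ∧ x.marked = false ∧ x.next = some n₂ ∧
        y.val ≠ Val.ofKey c.key
  | .mark n₁ n₂ => c.op = .remove ∧
      ∃ x y, Locked P h c n₁ n₂ x y ∧ x.marked = false ∧ y.marked = false ∧ x.next = some n₂ ∧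
        y.val = Val.ofKey c.key
  | .readSucc n₁ n₂ => c.op = .remove ∧
      ∃ x y, Locked P h c n₁ n₂ x y ∧ x.marked = false ∧ y.marked = true ∧ x.next = some n₂
  | .unlink n₁ n₂ m => c.op = .remove ∧
      ∃ x y, Locked P h c n₁ n₂ x y ∧ x.marked = false ∧ y.marked = true ∧ x.next = some n₂ ∧
        y.next = m
  | .release₁ n₁ n₂ _ => c.op ≠ .contains ∧ ∃ x y, Locked P h c n₁ n₂ x y
  | .release₂ _ n₂ _ => c.op ≠ .contains ∧
      n₂ ∈ P ∧ ∃ y, h n₂ = some y ∧ y.lock = some c.thread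
  | .conHead => c.op = .contains
  | .conTest n => c.op = .contains ∧ n ∈ P
  | .conNext n => c.op = .contains ∧ n ∈ P
  | .conVal n => c.op = .contains ∧ n ∈ P ∧ ∃ x, h n = some x ∧ ¬ x.val < Val.ofKey c.key
  | .conMark n => c.op = .contains ∧ n ∈ P ∧ ∃ x, h n = some x ∧ x.val = Val.ofKey c.key
  | .ret _ => True

/-- The node created by the call that is about to execute this statement and not yet linked. -/
def Instr.fresh : Instr → Option ℕ
  | .linkNew _ _ n₃ => some n₃
  | .insert _ _ n₃ => some n₃
  | _ => none

/-- The node that this statement links into the list. -/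
def Instr.published : Instr → Set ℕ
  | .insert _ _ n₃ => {n₃}
  | _ => ∅

/-! ### Values, and consequences of well-formedness. -/

theorem Val.bot_lt_ofKey (k : ℤ) : ⊥ < Val.ofKey k := WithBot.bot_lt_coe _

theorem Val.ofKey_lt_top (k : ℤ) : Val.ofKey k < ⊤ :=
  WithBot.coe_lt_coe.2 (WithTop.coe_lt_top k)

theorem Val.ofKey_injective : Function.Injective Val.ofKey :=
  WithBot.coe_injective.comp WithTop.coe_injective

theorem HeapOK.mem_of_reach {P : Set ℕ} {h : Heap T} (hP : HeapOK P h) {a b : ℕ} (ha : a ∈ P)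
    (hr : Reach h a b) : b ∈ P := by
  induction hr with
  | refl => exact ha
  | tail _ hp ih =>
    obtain ⟨x, hx, hn⟩ := hp
    exact (hP.next _ ih x _ hx hn).1

theorem HeapOK.eq_or_lt_of_reach {P : Set ℕ} {h : Heap T} (hP : HeapOK P h) {a b : ℕ}
    (ha : a ∈ P) (hr : Reach h a b) {x y : Node T} (hx : h a = some x) (hy : h b = some y) :
    a = b ∨ x.val < y.val := by
  induction hr generalizing y with
  | refl => exact .inl rfl
  | tail hr hp ih =>
    obtain ⟨z, hz, hn⟩ := hp
    obtain ⟨-, y', hy', hlt⟩ := hP.next _ (hP.mem_of_reach ha hr) z _ hz hn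
    obtain rfl : y' = y := by grind
    rcases ih hz with rfl | h'
    · grind
    · exact .inr (h'.trans hlt)

/-- Both nodes lie on the one path from `head`, so one reaches the other, and values strictly
increase on the way. This is why marking a single node removes its key from the abstract set. -/
theorem HeapOK.eq_of_val_eq {P : Set ℕ} {h : Heap T} (hP : HeapOK P h) {a b : ℕ}
    (ha : a ∈ P) (hb : b ∈ P) {x y : Node T} (hx : h a = some x) (hy : h b = some y)
    (hxm : x.marked = false) (hym : y.marked = false) (hv : x.val = y.val) : a = b := by
  rcases (hP.reach a ha x hx hxm).total (hP.reach b hb y hy hym) with hr | hr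
  · rcases hP.eq_or_lt_of_reach ha hr hx hy with h | h
    · exact h
    · exact absurd hv h.ne
  · rcases hP.eq_or_lt_of_reach hb hr hy hx with h | h
    · exact h.symm
    · exact absurd hv h.ne'

/-- The invariant makes reachability of unmarked linked nodes automatic. What remains is a
node-by-node condition, which is easy to follow through a single write. -/
theorem HeapOK.mem_abs_iff {P : Set ℕ} {S : State T} (hP : HeapOK P S.heap) {k : ℤ} :
    k ∈ S.abs ↔ ∃ a ∈ P, ∃ x, S.heap a = some x ∧ x.marked = false ∧ x.val = Val.ofKey k := by
  constructor
  · rintro ⟨a, ⟨hr, x, hx, hm⟩, y, hy, hv⟩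
    obtain rfl : x = y := by grind
    exact ⟨a, hP.mem_of_reach hP.head_mem hr, x, hx, hm, hv⟩
  · rintro ⟨a, ha, x, hx, hm, hv⟩
    exact ⟨a, ⟨hP.reach a ha x hx hm, x, hx, hm⟩, x, hx, hv⟩

/-- No key strictly inside a window of adjacent nodes is in the abstract set. -/
theorem Window.notMem_abs {P : Set ℕ} {S : State T} {c : Call T} {n₁ n₂ : ℕ} {x y : Node T}
    (hw : Window P S.heap c n₁ n₂ x y) (hP : HeapOK P S.heap) (hm : x.marked = false)
    (hn : x.next = some n₂) (hv : y.val ≠ Val.ofKey c.key) : c.key ∉ S.abs := by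
  rw [hP.mem_abs_iff]
  rintro ⟨a, ha, z, hz, hzm, hzv⟩
  have hlt := hw.lt
  have hgt : Val.ofKey c.key < y.val := lt_of_le_of_ne (not_lt.1 hw.ge) hv.symm
  -- A node `a ≠ n₁` after `n₁` lies at or after `n₂`, so its value is at least that of `n₂`, beyond
  -- the key; a node at or before `n₁` has a value below the key.
  rcases (hP.reach n₁ hw.mem₁ x hw.get₁ hm).total (hP.reach a ha z hz hzm) with hr | hr
  · have hne : n₁ ≠ a := by
      rintro rfl
      obtain rfl : x = z := by have := hw.get₁; grind
      exact absurd hzv hlt.ne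
    have hr' := hr.next hne ⟨x, hw.get₁, hn⟩
    rcases hP.eq_or_lt_of_reach hw.mem₂ hr' hw.get₂ hz with rfl | h'
    · obtain rfl : y = z := by have := hw.get₂; grind
      exact hv hzv
    · exact lt_asymm h' (hzv ▸ hgt)
  · rcases hP.eq_or_lt_of_reach ha hr hz hw.get₁ with rfl | h'
    · obtain rfl : x = z := by have := hw.get₁; grind
      exact absurd hzv hlt.ne
    · exact lt_asymm h' (hzv ▸ hlt)

/-! ### Effect of one statement on the memory -/

/-- Statements keep nodes and their values, and do not unmark them. -/
theorem MemStep.node_evolves {c : Call T} {h h' : Heap T} {s s' : Instr}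
    (hs : MemStep c h s h' s') {a : ℕ} {x : Node T} (hx : h a = some x) :
    ∃ x', h' a = some x' ∧ x'.val = x.val ∧ (x.marked = true → x'.marked = true) := by
  cases hs <;> grind [Heap.set_apply]

theorem Reach.mono_of_points {h h' : Heap T} {a m : ℕ} (hr : Reach h a m)
    (hp : ∀ a b, Points h a b → Points h' a b) : Reach h' a m :=
  Relation.ReflTransGen.mono hp _ _ hr

theorem Points.set {h : Heap T} {a : ℕ} {x y : Node T} (hx : h a = some x)
    (hn : x.next = none ∨ y.next = x.next) (b d : ℕ) (hp : Points h b d) :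
    Points (h.set a y) b d := by
  obtain ⟨z, hz, hd⟩ := hp
  by_cases hb : b = a
  · subst hb
    exact ⟨y, h.set_self .., by grind⟩
  · exact ⟨z, by rw [h.set_of_ne y hb, hz], hd⟩

theorem Points.set_fresh {h : Heap T} {a : ℕ} {y : Node T} (hx : h a = none) (b d : ℕ)
    (hp : Points h b d) : Points (h.set a y) b d := by
  obtain ⟨z, hz, hd⟩ := hp
  have hb : b ≠ a := by rintro rfl; simp [hx] at hz
  exact ⟨z, by rw [h.set_of_ne y hb, hz], hd⟩

/-- Statements preserve paths to nodes that are still unmarked afterwards. -/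
theorem MemStep.reach {P : Set ℕ} {c : Call T} {h h' : Heap T} {s s' : Instr}
    (hs : MemStep c h s h' s') (hf : FrameOK P h c s) {a m : ℕ} (hr : Reach h a m)
    (hm : ∃ z, h' m = some z ∧ z.marked = false) : Reach h' a m := by
  cases hs with
  -- The edge from `n₁` to `n₂` is replaced by two edges through `n₃`, so every path through `n₁`
  -- can be rerouted.
  | insert n₁ n₂ n₃ x hx =>
    obtain ⟨-, hn₃, hz, x', y, hL, -, hn, -⟩ := hf
    obtain rfl : x' = x := by have := hL.get₁; grind
    have h31 : n₃ ≠ n₁ := fun e => hn₃ (e ▸ hL.mem₁)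
    induction hr using Relation.ReflTransGen.head_induction_on with
    | refl => exact .refl
    | head hp _ ih =>
      rename_i b d _
      by_cases hb : b = n₁
      · subst hb
        obtain rfl := hp.unique ⟨_, hx, hn⟩
        exact .head ⟨_, Heap.set_self .., rfl⟩
          (.head ⟨_, by rw [Heap.set_of_ne _ _ h31, hz], rfl⟩ ih)
      · obtain ⟨w, hw, hwn⟩ := hp
        exact .head ⟨w, by rw [Heap.set_of_ne _ _ hb, hw], hwn⟩ ih
  | unlink n₁ n₂ m' x hx =>
    obtain ⟨-, x', y, hL, -, hym, hn, hym'⟩ := hf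
    obtain rfl : x' = x := by have := hL.get₁; grind
    have h21 : n₂ ≠ n₁ := by
      rintro rfl
      have := hL.get₁; have := hL.get₂; have := hL.lt; have := hL.ge; grind
    have hy' : h.set n₁ { x' with next := m' } n₂ = some y := by
      rw [Heap.set_of_ne _ _ h21, hL.get₂]
    -- The target is unmarked while `n₂` is marked, so a path through `n₁` does not end at `n₂` and
    -- can take the shortcut from `n₁` to the successor of `n₂`.
    have h2m : n₂ ≠ m := by rintro rfl; grind
    induction hr using Relation.ReflTransGen.head_induction_on with
    | refl => exact .refl
    | head hp _ ih =>
      rename_i b d _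
      by_cases hb : b = n₁
      · subst hb
        obtain rfl := hp.unique ⟨_, hx, hn⟩
        rcases Relation.ReflTransGen.cases_head ih with rfl | ⟨e, he, hr⟩
        · exact absurd rfl h2m
        · refine .head ⟨_, Heap.set_self .., ?_⟩ hr
          obtain ⟨w, hw, hwe⟩ := he
          obtain rfl : y = w := by grind
          simpa [hym'] using hwe
      · obtain ⟨w, hw, hwn⟩ := hp
        exact .head ⟨w, by rw [Heap.set_of_ne _ _ hb, hw], hwn⟩ ih
  | linkNew n₁ n₂ n₃ z hz =>
    obtain ⟨-, -, hz', -⟩ := hf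
    -- The overwritten reference was null, so no edge is lost.
    exact hr.mono_of_points (Points.set hz (.inl (by grind)))
  | newNode n₁ n₂ n₃ hz => exact hr.mono_of_points (Points.set_fresh hz)
  | acquire₁ _ _ _ hx => exact hr.mono_of_points (Points.set hx (.inr rfl))
  | acquire₂ _ _ _ hx => exact hr.mono_of_points (Points.set hx (.inr rfl))
  | retry₁ _ _ _ hx => exact hr.mono_of_points (Points.set hx (.inr rfl))
  | retry₂ _ _ _ hx => exact hr.mono_of_points (Points.set hx (.inr rfl))
  | release₁ _ _ _ _ hx => exact hr.mono_of_points (Points.set hx (.inr rfl))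
  | release₂ _ _ _ _ hx => exact hr.mono_of_points (Points.set hx (.inr rfl))
  | mark _ _ _ hx => exact hr.mono_of_points (Points.set hx (.inr rfl))
  | _ => exact hr

theorem Window.ne {P : Set ℕ} {h : Heap T} {c : Call T} {n₁ n₂ : ℕ} {x y : Node T}
    (hw : Window P h c n₁ n₂ x y) : n₁ ≠ n₂ := by
  rintro rfl
  have := hw.get₁; have := hw.get₂; have := hw.lt; have := hw.ge; grind

theorem Window.set₁ {P : Set ℕ} {h : Heap T} {c : Call T} {n₁ n₂ : ℕ} {x y x' : Node T}
    (hw : Window P h c n₁ n₂ x y) (hv : x'.val = x.val) :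
    Window P (h.set n₁ x') c n₁ n₂ x' y :=
  ⟨hw.mem₁, hw.mem₂, h.set_self .., by rw [h.set_of_ne _ hw.ne.symm, hw.get₂], hv ▸ hw.lt, hw.ge⟩

theorem Window.set₂ {P : Set ℕ} {h : Heap T} {c : Call T} {n₁ n₂ : ℕ} {x y y' : Node T}
    (hw : Window P h c n₁ n₂ x y) (hv : y'.val = y.val) :
    Window P (h.set n₂ y') c n₁ n₂ x y' :=
  ⟨hw.mem₁, hw.mem₂, by rw [h.set_of_ne _ hw.ne, hw.get₁], h.set_self .., hw.lt, hv ▸ hw.ge⟩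


/-! ### Non-interference between threads. -/

/-- Memory evolution as seen by a thread `t` that does not take the step. -/
structure Rely (P : Set ℕ) (t : T) (a₀ : Option ℕ) (h h' : Heap T) : Prop where
  val : ∀ a x, h a = some x → ∃ x', h' a = some x' ∧ x'.val = x.val
  locked : ∀ a x, h a = some x → x.lock = some t → h' a = some x
  fresh : ∀ a, a ∉ P → h a ≠ none → a₀ ≠ some a → h' a = h a

/-- A statement writes only to a node locked by its own thread, to an unlocked node that it is
locking, to a free address, or to its own node not yet linked. None of these is locked by another
thread `t`, nor is any of them the unlinked node of another call. -/
theorem MemStep.rely {P : Set ℕ} {c : Call T} {h h' : Heap T} {s s' : Instr}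
    (hs : MemStep c h s h' s') (hf : FrameOK P h c s) {t : T} (ht : t ≠ c.thread) :
    Rely P t s.fresh h h' := by
  refine ⟨fun a x hx => ?_, fun a x hx hl => ?_, fun a ha hx hn => ?_⟩
  · obtain ⟨x', h1, h2, -⟩ := hs.node_evolves hx
    exact ⟨x', h1, h2⟩
  · cases hs <;> simp only [FrameOK] at hf <;>
      grind [Heap.set_apply, Locked, Window]
  · cases hs <;> simp only [FrameOK, Instr.fresh] at hf hn <;>
      grind [Heap.set_apply, Locked, Window]

theorem Window.rely {P P' : Set ℕ} {t : T} {a₀ : Option ℕ} {h h' : Heap T} {c : Call T}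
    {n₁ n₂ : ℕ} {x y : Node T} (hw : Window P h c n₁ n₂ x y) (hr : Rely P t a₀ h h')
    (hP : P ⊆ P') : ∃ x' y', Window P' h' c n₁ n₂ x' y' := by
  obtain ⟨x', hx', hxv⟩ := hr.val _ _ hw.get₁
  obtain ⟨y', hy', hyv⟩ := hr.val _ _ hw.get₂
  exact ⟨x', y', hP hw.mem₁, hP hw.mem₂, hx', hy', hxv ▸ hw.lt, hyv ▸ hw.ge⟩

theorem Locked.rely {P P' : Set ℕ} {a₀ : Option ℕ} {h h' : Heap T} {c : Call T}
    {n₁ n₂ : ℕ} {x y : Node T} (hw : Locked P h c n₁ n₂ x y) (hr : Rely P c.thread a₀ h h')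
    (hP : P ⊆ P') : Locked P' h' c n₁ n₂ x y :=
  ⟨⟨hP hw.mem₁, hP hw.mem₂, hr.locked _ _ hw.get₁ hw.lock₁, hr.locked _ _ hw.get₂ hw.lock₂,
    hw.lt, hw.ge⟩, hw.lock₁, hw.lock₂⟩

/-- What a call knows about the memory is not invalidated by the steps of other threads. -/
theorem FrameOK.rely {P P' : Set ℕ} {a₀ : Option ℕ} {h h' : Heap T} {c : Call T} {s : Instr}
    (hf : FrameOK P h c s) (hr : Rely P c.thread a₀ h h') (hP : P ⊆ P')
    (hn : ∀ a, s.fresh = some a → a ∉ P' ∧ a₀ ≠ some a) : FrameOK P' h' c s := by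
  have hv := hr.val
  have hl := hr.locked
  cases s with
  | acquire₁ n₁ n₂ =>
    obtain ⟨ho, x, y, hw⟩ := hf
    exact ⟨ho, hw.rely hr hP⟩
  | acquire₂ n₁ n₂ =>
    obtain ⟨ho, x, y, hw, hlk⟩ := hf
    obtain ⟨y', hy', hyv⟩ := hv _ _ hw.get₂
    exact ⟨ho, x, y', ⟨hP hw.mem₁, hP hw.mem₂, hl _ _ hw.get₁ hlk, hy', hw.lt, hyv ▸ hw.ge⟩, hlk⟩
  | linkNew n₁ n₂ n₃ =>
    obtain ⟨ho, hn₃, hz, x, y, hL, hw⟩ := hf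
    have := hn n₃ rfl
    exact ⟨ho, this.1, by rw [hr.fresh n₃ hn₃ (by simp [hz]) this.2, hz], x, y, hL.rely hr hP, hw⟩
  | insert n₁ n₂ n₃ =>
    obtain ⟨ho, hn₃, hz, x, y, hL, hw⟩ := hf
    have := hn n₃ rfl
    exact ⟨ho, this.1, by rw [hr.fresh n₃ hn₃ (by simp [hz]) this.2, hz], x, y, hL.rely hr hP, hw⟩
  | validate₁ | retry₁ | release₁ =>
    obtain ⟨ho, x, y, hL⟩ := hf
    exact ⟨ho, x, y, hL.rely hr hP⟩
  | validate₂ | validate₃ | check | newNode | mark | readSucc | unlink =>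
    obtain ⟨ho, x, y, hL, hw⟩ := hf
    exact ⟨ho, x, y, hL.rely hr hP, hw⟩
  | _ => simp only [FrameOK] at hf ⊢ <;> grind

theorem Window.eq₁ {P : Set ℕ} {h : Heap T} {c : Call T} {n₁ n₂ : ℕ} {x y z : Node T}
    (hw : Window P h c n₁ n₂ x y) (hz : h n₁ = some z) : x = z :=
  Option.some.inj (hw.get₁.symm.trans hz)

theorem Window.eq₂ {P : Set ℕ} {h : Heap T} {c : Call T} {n₁ n₂ : ℕ} {x y z : Node T}
    (hw : Window P h c n₁ n₂ x y) (hz : h n₂ = some z) : y = z :=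
  Option.some.inj (hw.get₂.symm.trans hz)

theorem Locked.set_of_notMem {P : Set ℕ} {h : Heap T} {c : Call T} {n₁ n₂ a : ℕ}
    {x y z : Node T} (hw : Locked P h c n₁ n₂ x y) (ha : a ∉ P) :
    Locked P (h.set a z) c n₁ n₂ x y :=
  ⟨⟨hw.mem₁, hw.mem₂, by rw [h.set_of_ne _ (by rintro rfl; exact ha hw.mem₁), hw.get₁],
    by rw [h.set_of_ne _ (by rintro rfl; exact ha hw.mem₂), hw.get₂], hw.lt, hw.ge⟩,
    hw.lock₁, hw.lock₂⟩

theorem Locked.mono {P P' : Set ℕ} {h : Heap T} {c : Call T} {n₁ n₂ : ℕ}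
    {x y : Node T} (hw : Locked P h c n₁ n₂ x y) (hP : P ⊆ P') :
    Locked P' h c n₁ n₂ x y :=
  ⟨⟨hP hw.mem₁, hP hw.mem₂, hw.get₁, hw.get₂, hw.lt, hw.ge⟩, hw.lock₁, hw.lock₂⟩

/-- After its own step, a call knows what its next statement relies on. -/
theorem MemStep.frameOK {P : Set ℕ} {c : Call T} {h h' : Heap T} {s s' : Instr}
    (hs : MemStep c h s h' s') (hP : HeapOK P h) (hf : FrameOK P h c s) :
    FrameOK (P ∪ s.published) h' c s' := by
  cases hs <;> simp only [FrameOK, Instr.published, Set.union_empty] at hf ⊢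
  case locHead => exact ⟨hf, trivial⟩
  case locFirst n₁ n₂ x hx hn =>
    obtain ⟨ho, rfl⟩ := hf
    obtain ⟨z, hz, hzv, -⟩ := hP.head_node
    exact ⟨ho, hP.head_mem, (hP.next _ hP.head_mem x _ hx hn).1, z, hz,
      hzv ▸ Val.bot_lt_ofKey _⟩
  case locTest_lt n₁ n₂ y hy hv => exact ⟨hf.1, hf.2.2.1, y, hy, hv⟩
  case locTest_ge n₁ n₂ y hy hv =>
    obtain ⟨ho, h1, h2, x, hx, hxv⟩ := hf
    exact ⟨ho, x, y, h1, h2, hx, hy, hxv, hv⟩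
  case locAdvance n₁ n₂ m y hy hn =>
    exact ⟨hf.1, hf.2.1, (hP.next _ hf.2.1 y _ hy hn).1, hf.2.2⟩
  case acquire₁ n₁ n₂ x hx hl =>
    obtain ⟨ho, x', y, hw⟩ := hf
    obtain rfl := hw.eq₁ hx
    exact ⟨ho, _, y, hw.set₁ rfl, rfl⟩
  case acquire₂ n₁ n₂ y hy hl =>
    obtain ⟨ho, x, y', hw, hlk⟩ := hf
    obtain rfl := hw.eq₂ hy
    exact ⟨ho, x, _, hw.set₂ rfl, hlk, rfl⟩
  case validate₁_ok n₁ n₂ x hx hm =>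
    obtain ⟨ho, x', y, hw⟩ := hf
    obtain rfl := hw.eq₁ hx
    exact ⟨ho, _, y, hw, hm⟩
  case validate₁_fail => exact hf
  case validate₂_ok n₁ n₂ y hy hm =>
    obtain ⟨ho, x, y', hw, hxm⟩ := hf
    obtain rfl := hw.eq₂ hy
    exact ⟨ho, x, _, hw, hxm, hm⟩
  case validate₂_fail =>
    obtain ⟨ho, x, y, hw, -⟩ := hf
    exact ⟨ho, x, y, hw⟩
  case validate₃_ok n₁ n₂ x hx hn =>
    obtain ⟨ho, x', y, hw, hm⟩ := hf
    obtain rfl := hw.eq₁ hx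
    exact ⟨ho, _, y, hw, hm.1, hm.2, hn⟩
  case validate₃_fail =>
    obtain ⟨ho, x, y, hw, -⟩ := hf
    exact ⟨ho, x, y, hw⟩
  case retry₁ n₁ n₂ x hx =>
    obtain ⟨ho, x', y, hw⟩ := hf
    exact ⟨ho, hw.mem₂, y, by rw [Heap.set_of_ne _ _ hw.ne.symm, hw.get₂], hw.lock₂⟩
  case retry₂ => exact hf.1
  case check_add_ne n₁ n₂ y hy ho hv =>
    obtain ⟨-, x, y', hw, hxm, hym, hn⟩ := hf
    obtain rfl := hw.eq₂ hy
    exact ⟨ho, x, _, hw, hxm, hn, hv⟩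
  case check_add_eq =>
    obtain ⟨ho, x, y, hw, -⟩ := hf
    exact ⟨ho, x, y, hw⟩
  case check_remove_eq n₁ n₂ y hy ho hv =>
    obtain ⟨-, x, y', hw, hxm, hym, hn⟩ := hf
    obtain rfl := hw.eq₂ hy
    exact ⟨ho, x, _, hw, hxm, hym, hn, hv⟩
  case check_remove_ne =>
    obtain ⟨ho, x, y, hw, -⟩ := hf
    exact ⟨ho, x, y, hw⟩
  case newNode n₁ n₂ n₃ hn₃ =>
    obtain ⟨ho, x, y, hw, hr⟩ := hf
    have h3 : n₃ ∉ P := fun hm => by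
      obtain ⟨z, hz⟩ := hP.alloc _ hm
      simp [hn₃] at hz
    exact ⟨ho, h3, Heap.set_self .., x, y, hw.set_of_notMem h3, hr⟩
  case linkNew n₁ n₂ n₃ z hz =>
    obtain ⟨ho, h3, hz', x, y, hw, hr⟩ := hf
    obtain rfl := Option.some.inj (hz.symm.trans hz')
    exact ⟨ho, h3, Heap.set_self .., x, y, hw.set_of_notMem h3, hr⟩
  case insert n₁ n₂ n₃ x hx =>
    obtain ⟨ho, h3, hz', x', y, hw, hr⟩ := hf
    obtain rfl := hw.eq₁ hx
    exact ⟨by simp [ho], _, y,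
      Locked.mono ⟨hw.set₁ rfl, hw.lock₁, hw.lock₂⟩ Set.subset_union_left⟩
  case mark n₁ n₂ y hy =>
    obtain ⟨ho, x, y', hw, hxm, -, hn, -⟩ := hf
    obtain rfl := hw.eq₂ hy
    exact ⟨ho, x, _, ⟨hw.set₂ rfl, hw.lock₁, hw.lock₂⟩, hxm, rfl, hn⟩
  case readSucc n₁ n₂ y hy =>
    obtain ⟨ho, x, y', hw, hr⟩ := hf
    obtain rfl := hw.eq₂ hy
    exact ⟨ho, x, _, hw, hr.1, hr.2.1, hr.2.2, rfl⟩
  case unlink n₁ n₂ m x hx =>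
    obtain ⟨ho, x', y, hw, hr⟩ := hf
    obtain rfl := hw.eq₁ hx
    exact ⟨by simp [ho], _, y, hw.set₁ rfl, hw.lock₁, hw.lock₂⟩
  case release₁ n₁ n₂ _ x hx =>
    obtain ⟨ho, x', y, hw⟩ := hf
    exact ⟨ho, hw.mem₂, y, by rw [Heap.set_of_ne _ _ hw.ne.symm, hw.get₂], hw.lock₂⟩
  case conHead => exact ⟨hf, hP.head_mem⟩
  case conTest_lt => exact hf
  case conTest_ge n x hx hv => exact ⟨hf.1, hf.2, x, hx, hv⟩
  case conNext n m x hx hn => exact ⟨hf.1, (hP.next _ hf.2 x _ hx hn).1⟩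
  case conVal_eq n x hx hv => exact ⟨hf.1, hf.2.1, x, hx, hv⟩

/-- Statements keep the memory well formed. -/
theorem MemStep.heapOK {P : Set ℕ} {c : Call T} {h h' : Heap T} {s s' : Instr}
    (hs : MemStep c h s h' s') (hP : HeapOK P h) (hf : FrameOK P h c s) :
    HeapOK (P ∪ s.published) h' := by
  have hback : ∀ a ∈ P, ∀ x', h' a = some x' → ∃ x, h a = some x ∧ x'.val = x.val ∧
      (x.marked = true → x'.marked = true) := by
    intro a ha x' hx'
    obtain ⟨x, hx⟩ := hP.alloc a ha
    obtain ⟨y, hy, hyv, hym⟩ := hs.node_evolves hx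
    obtain rfl := Option.some.inj (hx'.symm.trans hy)
    exact ⟨x, hx, hyv, hym⟩
  -- A node unmarked now was unmarked before, hence reachable before, and `MemStep.reach` carries
  -- the path over.
  have hreach : ∀ a ∈ P, ∀ x', h' a = some x' → x'.marked = false → Reach h' head a := by
    intro a ha x' hx' hm
    obtain ⟨x, hx, -, hxm⟩ := hback a ha x' hx'
    refine hs.reach hf (hP.reach a ha x hx ?_) ⟨x', hx', hm⟩
    by_contra hc
    simp [hxm (by simpa using hc)] at hm
  have hnext : ∀ a ∈ P, ∀ x' b, h' a = some x' → x'.next = some b →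
      b ∈ P ∪ s.published ∧ ∃ y, h' b = some y ∧ x'.val < y.val := by
    intro a ha x' b hx' hb
    -- Covers every node whose `next` the statement leaves alone; only `insert` and `unlink`
    -- redirect a reference inside `P`.
    have hold : ∀ x, h a = some x → x.next = some b →
        b ∈ P ∪ s.published ∧ ∃ y, h' b = some y ∧ x'.val < y.val := by
      intro x hx hxb
      obtain ⟨hbP, y, hy, hlt⟩ := hP.next a ha x b hx hxb
      obtain ⟨y', hy', hyv, -⟩ := hs.node_evolves hy
      obtain ⟨z, hz, hzv, -⟩ := hback a ha x' hx'
      obtain rfl := Option.some.inj (hx.symm.trans hz)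
      exact ⟨.inl hbP, y', hy', by rw [hzv, hyv]; exact hlt⟩
    obtain ⟨x, hx⟩ := hP.alloc a ha
    cases hs <;> try exact hold x' hx' hb
    case insert n₁ n₂ n₃ x₁ hx₁ =>
      obtain ⟨-, h3, hz, x₁', y, hw, -, -, -⟩ := hf
      obtain rfl := hw.eq₁ hx₁
      by_cases ha1 : a = n₁
      · subst ha1
        rw [Heap.set_self] at hx'
        obtain rfl := Option.some.inj hx'
        obtain rfl : n₃ = b := by simpa using hb
        have hz' : h.set a { x₁' with next := some n₃ } n₃ =
            some ⟨Val.ofKey c.key, some n₂, false, none⟩ := by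
          rw [Heap.set_of_ne _ _ (by rintro rfl; exact h3 ha), hz]
        exact ⟨.inr rfl, _, hz', hw.lt⟩
      · rw [Heap.set_of_ne _ _ ha1] at hx'
        exact hold x' hx' hb
    case unlink n₁ n₂ m x₁ hx₁ =>
      obtain ⟨-, x₁', y, hw, -, -, hn, hm⟩ := hf
      obtain rfl := hw.eq₁ hx₁
      by_cases ha1 : a = n₁
      · subst ha1
        rw [Heap.set_self] at hx'
        obtain rfl := Option.some.inj hx'
        obtain ⟨hbP, z, hz, hlt⟩ := hP.next n₂ hw.mem₂ y b hw.get₂ (by simpa [hm] using hb)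
        obtain ⟨-, y', hy', hlt'⟩ := hP.next a ha x₁' n₂ hx₁ hn
        obtain rfl := hw.eq₂ hy'
        -- `unlink` contracts two increasing edges into one. Since values increase, `b` is not the
        -- node being written, so its contents are still `z`.
        have hba : b ≠ a := by
          rintro rfl
          obtain rfl := hw.eq₁ hz
          exact lt_asymm hlt hlt'
        exact ⟨.inl hbP, z, by rw [Heap.set_of_ne _ _ hba, hz], hlt'.trans hlt⟩
      · rw [Heap.set_of_ne _ _ ha1] at hx'
        exact hold x' hx' hb
    case newNode n₁ n₂ n₃ hn₃ =>
      rw [Heap.set_of_ne _ _ (by rintro rfl; simp [hn₃] at hx)] at hx'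
      exact hold x' hx' hb
    case linkNew n₁ n₂ n₃ z hz =>
      obtain ⟨-, h3, -⟩ := hf
      rw [Heap.set_of_ne _ _ (by rintro rfl; exact h3 ha)] at hx'
      exact hold x' hx' hb
    all_goals
      rw [Heap.set_apply] at hx'
      split_ifs at hx' with hh
      · subst hh
        obtain rfl := Option.some.inj hx'
        exact hold x hx (by grind)
      · exact hold x' hx' hb
  have hhead : ∃ x, h' head = some x ∧ x.val = ⊥ ∧ x.marked = false := by
    obtain ⟨x, hx, hv, hm⟩ := hP.head_node
    obtain ⟨x', hx', hv', -⟩ := hs.node_evolves hx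
    refine ⟨x', hx', hv'.trans hv, ?_⟩
    cases hs <;> try grind [Heap.set_apply]
    case mark n₁ n₂ y hy =>
      obtain ⟨-, x₁, y', hw, -⟩ := hf
      obtain rfl := hw.eq₂ hy
      rw [Heap.set_of_ne] at hx'
      · grind
      · rintro rfl
        obtain rfl := hw.eq₂ hx
        -- A marked node has a value not below the key, so it is not `head`.
        exact hw.ge (hv ▸ Val.bot_lt_ofKey _)
  have halloc : ∀ a ∈ P, ∃ x, h' a = some x := fun a ha => by
    obtain ⟨x, hx⟩ := hP.alloc a ha
    obtain ⟨x', hx', -⟩ := hs.node_evolves hx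
    exact ⟨x', hx'⟩
  -- Only `insert` enlarges `P`. The new node is reachable through its unmarked predecessor, and its
  -- value lies strictly between its neighbours.
  by_cases hins : ∃ n₁ n₂ n₃, s = .insert n₁ n₂ n₃
  · obtain ⟨n₁, n₂, n₃, rfl⟩ := hins
    cases hs with
    | insert _ _ _ x hx =>
    have hrn := fun hx₁ => hreach n₁ hx₁ _ (Heap.set_self ..)
    obtain ⟨-, h3, hz, x', y, hw, hxm, hn, hyv⟩ := hf
    obtain rfl := hw.eq₁ hx
    have h31 : n₃ ≠ n₁ := fun e => h3 (e ▸ hw.mem₁)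
    have hz' : h.set n₁ { x' with next := some n₃ } n₃ =
        some ⟨Val.ofKey c.key, some n₂, false, none⟩ := by rw [Heap.set_of_ne _ _ h31, hz]
    refine ⟨.inl hP.head_mem, hhead, ?_, ?_, ?_⟩
    · rintro a (ha | rfl)
      · exact halloc a ha
      · exact ⟨_, hz'⟩
    · rintro a (ha | rfl)
      · exact hnext a ha
      · intro w b hw' hb
        obtain rfl := Option.some.inj (hz'.symm.trans hw')
        obtain rfl : n₂ = b := by simpa using hb
        exact ⟨.inl hw.mem₂, y, by rw [Heap.set_of_ne _ _ hw.ne.symm, hw.get₂],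
          lt_of_le_of_ne (not_lt.1 hw.ge) hyv.symm⟩
    · rintro a (ha | rfl)
      · exact hreach a ha
      · intro w hw' _
        exact .tail (hrn hw.mem₁ hxm) ⟨_, Heap.set_self .., rfl⟩
  · have : s.published = ∅ := by
      cases s <;> simp_all [Instr.published]
    simp only [this, Set.union_empty] at hnext ⊢
    exact ⟨hP.head_mem, hhead, halloc, hnext, hreach⟩

end LazyList

namespace LazyList

universe u

variable {T : Type u}

/-! ### Effect of one statement on the abstract set -/

/-- Such a statement adds nothing to `P` and changes neither values nor marks there, so the
node-by-node description of the abstract set is unaffected. In particular the physical `unlink` is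
invisible. -/
theorem MemStep.abs_eq {P : Set ℕ} {c : Call T} {S S' : State T} {s s' : Instr}
    (hs : MemStep c S.heap s S'.heap s') (hP : HeapOK P S.heap) (hf : FrameOK P S.heap c s)
    (hi : ∀ n₁ n₂ n₃, s ≠ .insert n₁ n₂ n₃) (hm : ∀ n₁ n₂, s ≠ .mark n₁ n₂) :
    S'.abs = S.abs := by
  have hP' := hs.heapOK hP hf
  have hp : s.published = ∅ := by cases s <;> simp_all [Instr.published]
  rw [hp, Set.union_empty] at hP'
  have key : ∀ a ∈ P, ∀ x, S.heap a = some x →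
      ∃ x', S'.heap a = some x' ∧ x'.val = x.val ∧ x'.marked = x.marked := by
    intro a ha x hx
    generalize S.heap = h at *
    generalize S'.heap = h' at *
    cases hs <;> grind [Heap.set_apply]
  ext k
  rw [hP.mem_abs_iff, hP'.mem_abs_iff]
  constructor
  · rintro ⟨a, ha, x', hx', hxm, hxv⟩
    obtain ⟨x, hx⟩ := hP.alloc a ha
    obtain ⟨y, hy, hyv, hym⟩ := key a ha x hx
    obtain rfl := Option.some.inj (hx'.symm.trans hy)
    exact ⟨a, ha, x, hx, hym ▸ hxm, hyv ▸ hxv⟩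
  · rintro ⟨a, ha, x, hx, hxm, hxv⟩
    obtain ⟨y, hy, hyv, hym⟩ := key a ha x hx
    exact ⟨a, ha, y, hy, hym.trans hxm, hyv.trans hxv⟩

/-- The locked adjacent window shows that the key is absent; `P` then gains exactly one node,
unmarked and carrying the key. -/
theorem MemStep.abs_insert {P : Set ℕ} {c : Call T} {S S' : State T} {n₁ n₂ n₃ : ℕ} {s' : Instr}
    (hs : MemStep c S.heap (.insert n₁ n₂ n₃) S'.heap s') (hP : HeapOK P S.heap)
    (hf : FrameOK P S.heap c (.insert n₁ n₂ n₃)) :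
    c.key ∉ S.abs ∧ S'.abs = Insert.insert c.key S.abs := by
  have hP' := hs.heapOK hP hf
  obtain ⟨-, h3, hz, x, y, hw, hxm, hn, hyv⟩ := hf
  refine ⟨hw.notMem_abs hP hxm hn hyv, ?_⟩
  have key : ∀ a x, S.heap a = some x →
      ∃ x', S'.heap a = some x' ∧ x'.val = x.val ∧ x'.marked = x.marked := by
    intro a x hx
    generalize S.heap = h at *
    generalize S'.heap = h' at *
    cases hs
    grind [Heap.set_apply]
  ext k
  rw [Set.mem_insert_iff, hP.mem_abs_iff, hP'.mem_abs_iff]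
  obtain ⟨z, hz', hzv, hzm⟩ := key _ _ hz
  constructor
  · rintro ⟨a, ha | rfl, x', hx', hxm, hxv⟩
    · obtain ⟨x, hx⟩ := hP.alloc a ha
      obtain ⟨y, hy, hyv, hym⟩ := key a x hx
      obtain rfl := Option.some.inj (hx'.symm.trans hy)
      exact .inr ⟨a, ha, x, hx, hym ▸ hxm, hyv ▸ hxv⟩
    · obtain rfl := Option.some.inj (hx'.symm.trans hz')
      exact .inl (Val.ofKey_injective (hxv.symm.trans hzv))
  · rintro (rfl | ⟨a, ha, x, hx, hxm, hxv⟩)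
    · exact ⟨n₃, .inr rfl, z, hz', hzm, hzv⟩
    · obtain ⟨y, hy, hyv, hym⟩ := key a x hx
      exact ⟨a, .inl ha, y, hy, hym.trans hxm, hyv.trans hxv⟩

/-- By `HeapOK.eq_of_val_eq` the node being marked is the only unmarked node of `P` with this value,
so exactly one key disappears. -/
theorem MemStep.abs_mark {P : Set ℕ} {c : Call T} {S S' : State T} {n₁ n₂ : ℕ} {s' : Instr}
    (hs : MemStep c S.heap (.mark n₁ n₂) S'.heap s') (hP : HeapOK P S.heap)
    (hf : FrameOK P S.heap c (.mark n₁ n₂)) :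
    c.key ∈ S.abs ∧ S'.abs = S.abs \ {c.key} := by
  have hP' := hs.heapOK hP hf
  obtain ⟨-, x, y, hw, -, hym, -, hyv⟩ := hf
  refine ⟨hP.mem_abs_iff.2 ⟨n₂, hw.mem₂, y, hw.get₂, hym, hyv⟩, ?_⟩
  have hset : S'.heap = S.heap.set n₂ { y with marked := true } := by
    generalize S.heap = h at *
    generalize S'.heap = h' at *
    cases hs with
    | mark _ _ y' hy' =>
      obtain rfl := hw.eq₂ hy'
      rfl
  ext k
  rw [Set.mem_sdiff, Set.mem_singleton_iff, hP.mem_abs_iff, hP'.mem_abs_iff, hset]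
  simp only [Instr.published, Set.union_empty]
  constructor
  · rintro ⟨a, ha, z, hz, hzm, hzv⟩
    have hne : a ≠ n₂ := by
      rintro rfl
      rw [Heap.set_self] at hz
      grind
    rw [Heap.set_of_ne _ _ hne] at hz
    refine ⟨⟨a, ha, z, hz, hzm, hzv⟩, ?_⟩
    rintro rfl
    exact hne (hP.eq_of_val_eq ha hw.mem₂ hz hw.get₂ hzm hym (hzv.trans hyv.symm))
  · rintro ⟨⟨a, ha, z, hz, hzm, hzv⟩, hk⟩
    refine ⟨a, ha, z, ?_, hzm, hzv⟩
    rw [Heap.set_of_ne, hz]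
    rintro rfl
    obtain rfl := hw.eq₂ hz
    exact hk (Val.ofKey_injective (hzv.symm.trans hyv))

/-! ### The invariant of global states -/

/-- The global state `S` is well formed, where `P` is the set of the nodes that have been linked
into the list at some time. -/
structure StateOK (P : Set ℕ) (S : State T) : Prop where
  heap : HeapOK P S.heap
  thread : ∀ t c s, S.frame t = some (c, s) → c.thread = t
  frame : ∀ t c s, S.frame t = some (c, s) → FrameOK P S.heap c s
  fresh : ∀ t t' c c' s s' a, S.frame t = some (c, s) → S.frame t' = some (c', s') →
    s.fresh = some a → s'.fresh = some a → t = t'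

/-- The node that this event links into the list. -/
def Event.published : Event T → Set ℕ
  | .mem _ s => s.published
  | _ => ∅

theorem StateOK.start : StateOK {head, tail} (State.start T) where
  heap := by
    have hp : Points (State.start T).heap head tail := ⟨⟨⊥, some tail, false, none⟩, by
      simp [State.start, initialHeap], rfl⟩
    refine ⟨by simp, ⟨⟨⊥, some tail, false, none⟩, by simp [State.start, initialHeap], rfl, rfl⟩,
      ?_, ?_, ?_⟩
    · rintro a (rfl | rfl) <;> simp [State.start, initialHeap, head, tail]
    · rintro a (rfl | rfl) x b hx hb
      · obtain rfl : (⟨⊥, some tail, false, none⟩ : Node T) = x := by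
          simpa [State.start, initialHeap] using hx
        obtain rfl : tail = b := by simpa using hb
        exact ⟨by simp, ⟨⊤, none, false, none⟩, by simp [State.start, initialHeap, head, tail],
          bot_lt_top⟩
      · obtain rfl : (⟨⊤, none, false, none⟩ : Node T) = x := by
          simpa [State.start, initialHeap, head, tail] using hx
        simp at hb
    · rintro a (rfl | rfl) _ _ _
      · exact .refl
      · exact .single hp
  thread := by simp [State.start]
  frame := by simp [State.start]
  fresh := by simp [State.start]

theorem Op.frameOK_entry (P : Set ℕ) (h : Heap T) (c : Call T) : FrameOK P h c c.op.entry := by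
  rcases ho : c.op <;> simp [Op.entry, FrameOK, ho]

theorem Op.fresh_entry (o : Op) : o.entry.fresh = none := by
  cases o <;> rfl

/-- A call obtains an unlinked node only at a free address, so it cannot coincide with the unlinked
node of another call, which is already allocated. -/
theorem MemStep.fresh {c : Call T} {h h' : Heap T} {s s' : Instr} (hs : MemStep c h s h' s')
    {a : ℕ} (ha : s'.fresh = some a) :
    (s.fresh = some a ∧ s.published = ∅) ∨ (h a = none ∧ h' a ≠ none ∧ s.published = ∅) := by
  cases hs <;> simp_all [Instr.fresh, Instr.published, Heap.set_self]

theorem MemStep.published_subset {c : Call T} {h h' : Heap T} {s s' : Instr}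
    (_ : MemStep c h s h' s') {a : ℕ} (ha : a ∈ s.published) : s.fresh = some a := by
  cases s <;> simp_all [Instr.fresh, Instr.published]

theorem FrameOK.fresh_ne_none {P : Set ℕ} {c : Call T} {h : Heap T} {s : Instr}
    (hf : FrameOK P h c s) {a : ℕ} (ha : s.fresh = some a) : a ∉ P ∧ h a ≠ none := by
  cases s <;> simp_all [Instr.fresh, FrameOK]

/-- A rely-guarantee argument: the acting call re-establishes its own knowledge by
`MemStep.frameOK`, and the knowledge of all others survives by `FrameOK.rely`. -/
theorem StateOK.step [DecidableEq T] {P : Set ℕ} {S S' : State T} {e : Event T}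
    (hS : StateOK P S) (he : Step S e S') : StateOK (P ∪ e.published) S' := by
  cases he with
  | inv c hf =>
    simp only [Event.published, Set.union_empty]
    refine ⟨hS.heap, ?_, ?_, ?_⟩
    · intro t d s hd
      simp only [Function.update_apply] at hd
      split_ifs at hd with ht
      · grind
      · exact hS.thread t d s hd
    · intro t d s hd
      simp only [Function.update_apply] at hd
      split_ifs at hd with ht
      · obtain ⟨rfl, rfl⟩ : c = d ∧ c.op.entry = s := by grind
        exact Op.frameOK_entry ..
      · exact hS.frame t d s hd
    · intro t t' d d' s s' a hd hd' hs hs'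
      have := Op.fresh_entry c.op
      simp only [Function.update_apply] at hd hd'
      split_ifs at hd hd' with ht ht' ht'
      · grind
      · grind
      · grind
      · exact hS.fresh t t' d d' s s' a hd hd' hs hs'
  | rsp c b hf =>
    simp only [Event.published, Set.union_empty]
    refine ⟨hS.heap, ?_, ?_, ?_⟩
    · intro t d s hd
      simp only [Function.update_apply] at hd
      split_ifs at hd with ht
      exact hS.thread t d s hd
    · intro t d s hd
      simp only [Function.update_apply] at hd
      split_ifs at hd with ht
      exact hS.frame t d s hd
    · intro t t' d d' s s' a hd hd' hs hs'
      simp only [Function.update_apply] at hd hd'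
      split_ifs at hd hd' with ht ht'
      exact hS.fresh t t' d d' s s' a hd hd' hs hs'
  | mem c s₀ s₁ h' hf hs =>
    have hF := hS.frame _ _ _ hf
    simp only [Event.published]
    refine ⟨hs.heapOK hS.heap hF, ?_, ?_, ?_⟩
    · intro t d s hd
      simp only [Function.update_apply] at hd
      split_ifs at hd with ht
      · grind
      · exact hS.thread t d s hd
    · intro t d s hd
      simp only [Function.update_apply] at hd
      split_ifs at hd with ht
      · obtain ⟨rfl, rfl⟩ : c = d ∧ s₁ = s := by grind
        exact hs.frameOK hS.heap hF
      · have hdt := hS.thread t d s hd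
        refine (hS.frame t d s hd).rely (hs.rely hF (hdt ▸ ht)) Set.subset_union_left ?_
        intro a ha
        -- Unlinked nodes have one owner, so the acting call neither overwrites nor publishes the
        -- one that `d` holds.
        have hne : s₀.fresh ≠ some a := fun h0 =>
          ht (hS.fresh t c.thread d c s s₀ a hd hf ha h0)
        refine ⟨?_, hne⟩
        rintro (hp | hp)
        · exact ((hS.frame t d s hd).fresh_ne_none ha).1 hp
        · exact hne (hs.published_subset hp)
    · have aux : ∀ t d s a, t ≠ c.thread → S.frame t = some (d, s) → s₁.fresh = some a →
          s.fresh = some a → False := by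
        intro t d s a ht hd h1 h2
        rcases hs.fresh h1 with ⟨h0, -⟩ | ⟨h0, -⟩
        · exact ht (hS.fresh t c.thread d c s s₀ a hd hf h2 h0)
        · exact ((hS.frame t d s hd).fresh_ne_none h2).2 h0
      intro t t' d d' s s' a hd hd' hs hs'
      simp only [Function.update_apply] at hd hd'
      split_ifs at hd hd' with ht ht' ht'
      · grind
      · obtain ⟨rfl, rfl⟩ : c = d ∧ s₁ = s := by grind
        exact (aux t' d' s' a ht' hd' hs hs').elim
      · obtain ⟨rfl, rfl⟩ : c = d' ∧ s₁ = s' := by grind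
        exact (aux t d s a ht hd hs' hs).elim
      · exact hS.fresh t t' d d' s s' a hd hd' hs hs'

/-! ### Executions -/

variable [DecidableEq T]

/-- The nodes that have been linked into the list before the event number `n`. -/
def Execution.linked (E : Execution T) : ℕ → Set ℕ
  | 0 => {head, tail}
  | n + 1 => E.linked n ∪ (E.ev n).published

theorem Execution.stateOK (E : Execution T) {n : ℕ} (hn : n ≤ E.len) :
    StateOK (E.linked n) (E.st n) := by
  induction n with
  | zero => rw [E.st_zero]; exact StateOK.start
  | succ n ih => exact (ih (by omega)).step (E.step n (by omega))

/-- The call `c` is in progress in the state number `n`, with `s` its next statement. -/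
def Execution.Active (E : Execution T) (n : ℕ) (c : Call T) (s : Instr) : Prop :=
  n ≤ E.len ∧ (E.st n).frame c.thread = some (c, s)

variable {E : Execution T} {c : Call T} {s s' : Instr} {i j n m : ℕ} {b b' : Bool}

theorem Execution.At.mem_step (h : E.At i (.mem c s)) :
    E.Active i c s ∧ ∃ s', E.Active (i + 1) c s' ∧
      MemStep c (E.st i).heap s (E.st (i + 1)).heap s' := by
  obtain ⟨hi, he⟩ := h
  have hs := E.step i hi
  rw [he] at hs
  generalize hS' : E.st (i + 1) = S' at hs
  cases hs with
  | mem _ _ s' h' hf hs =>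
    exact ⟨⟨hi.le, hf⟩, s', ⟨hi, by rw [hS']; simp⟩, hs⟩

theorem Execution.At.inv_step (h : E.At i (.inv c)) :
    (E.st i).frame c.thread = none ∧ E.Active (i + 1) c c.op.entry ∧
      (E.st (i + 1)).heap = (E.st i).heap := by
  obtain ⟨hi, he⟩ := h
  have hs := E.step i hi
  rw [he] at hs
  generalize hS' : E.st (i + 1) = S' at hs
  cases hs with
  | inv _ hf => exact ⟨hf, ⟨hi, by rw [hS']; simp⟩, rfl⟩

theorem Execution.At.rsp_step (h : E.At i (.rsp c b)) :
    E.Active i c (.ret b) ∧ (E.st (i + 1)).frame c.thread = none ∧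
      (E.st (i + 1)).heap = (E.st i).heap := by
  obtain ⟨hi, he⟩ := h
  have hs := E.step i hi
  rw [he] at hs
  generalize hS' : E.st (i + 1) = S' at hs
  cases hs with
  | rsp _ _ hf => exact ⟨⟨hi.le, hf⟩, by simp, rfl⟩

/-- A call in progress was just invoked, or has just taken a step, or was in the same situation. -/
theorem Execution.Active.pred (h : E.Active (n + 1) c s) :
    (E.At n (.inv c) ∧ s = c.op.entry) ∨
      (∃ s₀, E.At n (.mem c s₀) ∧ E.Active n c s₀ ∧
        MemStep c (E.st n).heap s₀ (E.st (n + 1)).heap s) ∨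
      (E.Active n c s ∧ ∀ s₀, ¬ E.At n (.mem c s₀)) := by
  obtain ⟨hn, hf⟩ := h
  have hs := E.step n hn
  generalize he : E.ev n = e at hs
  generalize hS' : E.st (n + 1) = S' at hs hf
  have hlt : n ≤ E.len := (Nat.lt_of_succ_le hn).le
  cases hs with
  | inv d hd =>
    simp only [Function.update_apply] at hf
    split_ifs at hf with ht
    · obtain ⟨rfl, rfl⟩ : d = c ∧ d.op.entry = s := by grind
      exact .inl ⟨⟨hn, he⟩, rfl⟩
    · exact .inr (.inr ⟨⟨hlt, hf⟩, by rintro s₀ ⟨-, h0⟩; simp [he] at h0⟩)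
  | rsp d b hd =>
    simp only [Function.update_apply] at hf
    split_ifs at hf with ht
    exact .inr (.inr ⟨⟨hlt, hf⟩, by rintro s₀ ⟨-, h0⟩; simp [he] at h0⟩)
  | mem d s₀ s₁ h' hd hs =>
    simp only [Function.update_apply] at hf
    split_ifs at hf with ht
    · obtain ⟨rfl, rfl⟩ : d = c ∧ s₁ = s := by grind
      exact .inr (.inl ⟨s₀, ⟨hn, he⟩, ⟨hlt, hd⟩, hs⟩)
    · refine .inr (.inr ⟨⟨hlt, hf⟩, ?_⟩)
      rintro s' ⟨-, h0⟩
      simp only [he, Event.mem.injEq] at h0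
      exact ht (by rw [h0.1])

theorem Execution.Active.exists_inv (h : E.Active n c s) : ∃ a < n, E.At a (.inv c) := by
  induction n generalizing s with
  | zero =>
    obtain ⟨-, hf⟩ := h
    simp [E.st_zero, State.start] at hf
  | succ n ih =>
    rcases h.pred with ⟨h0, -⟩ | ⟨s₀, -, h0, -⟩ | ⟨h0, -⟩
    · exact ⟨n, by omega, h0⟩
    · obtain ⟨a, ha, h1⟩ := ih h0
      exact ⟨a, by omega, h1⟩
    · obtain ⟨a, ha, h1⟩ := ih h0
      exact ⟨a, by omega, h1⟩

/-- Traced backwards, activity can begin only at an invocation, and `inv_unique` makes that the one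
at `a`. -/
theorem Execution.Active.of_inv {a : ℕ} (ha : E.At a (.inv c)) (han : a < n) (hnm : n ≤ m)
    (h : E.Active m c s) : ∃ s', E.Active n c s' := by
  induction m, hnm using Nat.le_induction generalizing s with
  | base => exact ⟨s, h⟩
  | succ m hm ih =>
    rcases h.pred with ⟨h0, -⟩ | ⟨s₀, -, h0, -⟩ | ⟨h0, -⟩
    · have := E.inv_unique a ha.1 m h0.1 c ha.2 h0.2
      omega
    · exact ih h0
    · exact ih h0

theorem Execution.Active.between (hi : E.Active i c s) (hj : E.Active j c s') (hin : i ≤ n)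
    (hnj : n ≤ j) : ∃ s'', E.Active n c s'' := by
  obtain ⟨a, ha, h⟩ := hi.exists_inv
  exact Execution.Active.of_inv h (by omega) hnj hj

/-- What is true of a call in one state and kept by its steps is true in later states. -/
theorem Execution.Active.induction {Q : Instr → Prop} (hi : E.Active i c s)
    (hj : E.Active j c s') (hij : i ≤ j) (h0 : Q s)
    (hQ : ∀ h t h' t', MemStep c h t h' t' → Q t → Q t') : Q s' := by
  induction j, hij using Nat.le_induction generalizing s' with
  | base =>
    have := hi.2.symm.trans hj.2
    grind
  | succ j hj' ih =>
    rcases hj.pred with ⟨h1, -⟩ | ⟨s₀, -, h1, h2⟩ | ⟨h1, -⟩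
    · obtain ⟨a, ha, h⟩ := hi.exists_inv
      have := E.inv_unique a h.1 j h1.1 c h.2 h1.2
      omega
    · exact hQ _ _ _ _ h2 (ih h1)
    · exact ih h1

/-- No call is in progress after its response. -/
theorem Execution.Active.lt_rsp (h : E.Active n c s) (hr : E.At i (.rsp c b)) : n ≤ i := by
  by_contra hlt
  obtain ⟨ha, hn, -⟩ := hr.rsp_step
  obtain ⟨s', -, hs'⟩ := ha.between h (n := i + 1) (by omega) (by omega)
  simp [hn] at hs'

theorem Execution.At.rsp_unique (h : E.At i (.rsp c b)) (h' : E.At j (.rsp c b')) :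
    i = j ∧ b = b' := by
  have h1 := h.rsp_step.1.lt_rsp h'
  have h2 := h'.rsp_step.1.lt_rsp h
  obtain rfl : i = j := by omega
  have := h.2.symm.trans h'.2
  grind

end LazyList

namespace LazyList

universe u

variable {T : Type u} {c : Call T} {s s' : Instr} {i j n m : ℕ} {b b' : Bool} {p : Point}

/-! ### The event that decides the return value of a call -/

/-- The progress of a call. -/
def Instr.phase : Instr → ℕ
  | .check .. => 1
  | .newNode .. => 2
  | .linkNew .. => 3
  | .insert .. => 4
  | .mark .. => 4
  | .readSucc .. => 5
  | .unlink .. => 6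
  | .release₁ .. => 7
  | .release₂ .. => 8
  | .ret _ => 9
  | .conVal _ => 1
  | .conMark _ => 2
  | _ => 0

/-- The return value, once it is decided. -/
def Instr.outcome : Instr → Option Bool
  | .readSucc .. => some true
  | .unlink .. => some true
  | .release₁ _ _ b => some b
  | .release₂ _ _ b => some b
  | .ret b => some b
  | _ => none

/-- The loops, that is, the retries of Locate and the traversal of Contains, stay in phase `0`. From
phase `1` on every step advances, so each later statement runs at most once per call. -/
theorem MemStep.phase_le {h h' : Heap T} (hs : MemStep c h s h' s') :
    s.phase ≤ s'.phase ∧ (1 ≤ s.phase → s.phase < s'.phase) := by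
  cases hs <;> simp [Instr.phase]

theorem MemStep.outcome {h h' : Heap T} (hs : MemStep c h s h' s') (hb : s.outcome = some b) :
    s'.outcome = some b := by
  cases hs <;> simp_all [Instr.outcome]

theorem State.abs_congr {S S' : State T} (h : S'.heap = S.heap) : S'.abs = S.abs := by
  simp only [State.abs, h]

/-- The traversal of Contains has not passed the node `m`. -/
def Instr.Before (h : Heap T) (m : ℕ) : Instr → Prop
  | .conTest n => Reach h n m
  | .conNext n => Reach h n m ∧ n ≠ m
  | .conVal n => Reach h n m
  | .conMark n => n = m
  | _ => True

theorem Instr.Before.mono {h h' : Heap T} (hs : s.Before h m)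
    (hr : ∀ a, Reach h a m → Reach h' a m) : s.Before h' m := by
  cases s <;> simp_all [Instr.Before]

/-- The traversal starts at `head`, which reaches every unmarked node, and leaves a node only if its
value is below the key, hence not `m`. A node that has the key and reaches `m` is `m`. All paths
here are in the memory before the step; `Instr.Before.mono` handles the change of memory. -/
theorem MemStep.before {P : Set ℕ} {h h' : Heap T} {x : Node T} (hs : MemStep c h s h' s')
    (hP : HeapOK P h) (hf : FrameOK P h c s) (hm : m ∈ P) (hx : h m = some x)
    (hxm : x.marked = false) (hv : x.val = Val.ofKey c.key) (hb : s.Before h m) :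
    s'.Before h m := by
  cases hs <;> try trivial
  case conHead => exact hP.reach m hm x hx hxm
  case conTest_lt n z hz hlt =>
    refine ⟨hb, ?_⟩
    rintro rfl
    obtain rfl := Option.some.inj (hx.symm.trans hz)
    exact hlt.ne hv
  case conNext n l z hz hn => exact hb.1.next hb.2 ⟨z, hz, hn⟩
  case conVal_eq n z hz hzv =>
    rcases hP.eq_or_lt_of_reach hf.2.1 hb hz hx with h1 | h1
    · exact h1
    · exact absurd (hzv.trans hv.symm) h1.ne

variable [DecidableEq T] {E : Execution T}

theorem Execution.Active.phase_le (hi : E.Active i c s) (hj : E.Active j c s') (hij : i ≤ j) :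
    s.phase ≤ s'.phase :=
  hi.induction (Q := fun t => s.phase ≤ t.phase) hj hij le_rfl
    fun _ _ _ _ hs h => h.trans hs.phase_le.1

theorem Execution.Active.outcome (hi : E.Active i c s) (hj : E.Active j c s') (hij : i ≤ j)
    (hb : s.outcome = some b) : s'.outcome = some b :=
  hi.induction (Q := fun t => t.outcome = some b) hj hij hb fun _ _ _ _ hs h => hs.outcome h

/-- After Locate, a call does not execute the same statement twice. -/
theorem Execution.At.eq_of_phase_eq (hi : E.At i (.mem c s)) (hj : E.At j (.mem c s'))
    (hp : 1 ≤ s.phase) (he : s.phase = s'.phase) : i = j := by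
  obtain ⟨hi1, t, hi2, hi3⟩ := hi.mem_step
  obtain ⟨hj1, t', hj2, hj3⟩ := hj.mem_step
  rcases lt_trichotomy i j with h | h | h
  · have := hi2.phase_le hj1 h
    have := hi3.phase_le.2 hp
    omega
  · exact h
  · have := hj2.phase_le hi1 h
    have := hj3.phase_le.2 (he ▸ hp)
    omega

/-- The event number `i` is the step of the call `c` that decides that it returns `b`. -/
def Execution.Decides (E : Execution T) (c : Call T) (i : ℕ) (b : Bool) : Prop :=
  ∃ s s', E.At i (.mem c s) ∧ E.Active i c s ∧ E.Active (i + 1) c s' ∧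
    MemStep c (E.st i).heap s (E.st (i + 1)).heap s' ∧ s.outcome = none ∧ s'.outcome = some b

theorem Execution.At.decides (h : E.At i (.mem c s)) (hs : s.outcome = none)
    (hb : ∀ s', MemStep c (E.st i).heap s (E.st (i + 1)).heap s' → s'.outcome = some b) :
    E.Decides c i b := by
  obtain ⟨h1, s', h2, h3⟩ := h.mem_step
  exact ⟨s, s', h, h1, h2, h3, hs, hb s' h3⟩

theorem Execution.Active.exists_decides (h : E.Active n c s) (hb : s.outcome = some b) :
    ∃ i < n, E.Decides c i b := by
  induction n generalizing s with
  | zero =>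
    obtain ⟨-, hf⟩ := h
    simp [E.st_zero, State.start] at hf
  | succ n ih =>
    rcases h.pred with ⟨-, rfl⟩ | ⟨s₀, h0, h1, hs⟩ | ⟨h1, -⟩
    · cases ho : c.op <;> simp [ho, Op.entry, Instr.outcome] at hb
    · cases h2 : s₀.outcome with
      | none => exact ⟨n, by omega, s₀, s, h0, h1, h, hs, h2, hb⟩
      | some b' =>
        obtain rfl : b' = b := by
          have := hs.outcome h2
          grind
        obtain ⟨i, hi, hd⟩ := ih h1 h2
        exact ⟨i, by omega, hd⟩
    · obtain ⟨i, hi, hd⟩ := ih h1 hb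
      exact ⟨i, by omega, hd⟩

theorem Execution.Decides.outcome (h : E.Decides c i b) (hn : E.Active n c s) (hin : i < n) :
    s.outcome = some b := by
  obtain ⟨_, s₁, -, -, h1, -, -, h2⟩ := h
  exact h1.outcome hn hin h2

/-- An outcome once fixed is kept by all later steps, so a second deciding step would start with an
outcome already present. -/
theorem Execution.Decides.unique (h : E.Decides c i b) (h' : E.Decides c j b') :
    i = j ∧ b = b' := by
  obtain ⟨s₀, s₁, -, h0, h1, -, ho, ho'⟩ := id h
  obtain ⟨t₀, t₁, -, h0', h1', -, hp, hp'⟩ := id h'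
  rcases lt_trichotomy i j with hij | rfl | hij
  · have := h.outcome h0' hij
    grind
  · have := h.outcome h1' (Nat.lt_succ_self _)
    grind
  · have := h'.outcome h0 hij
    grind

theorem Execution.Decides.rsp (h : E.Decides c i b) (hr : E.At j (.rsp c b')) :
    i < j ∧ b = b' := by
  obtain ⟨i', hi', hd⟩ := hr.rsp_step.1.exists_decides (b := b') rfl
  obtain ⟨rfl, rfl⟩ := h.unique hd
  exact ⟨hi', rfl⟩

theorem Execution.At.frameOK (h : E.At i (.mem c s)) :
    FrameOK (E.linked i) (E.st i).heap c s :=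
  (E.stateOK h.1.le).frame _ _ _ h.mem_step.1.2

/-- The forms of the event that decides the return value. -/
theorem Execution.Decides.cases (h : E.Decides c i b) :
    (c.op = .add ∧ b = true ∧ ∃ n₁ n₂ n₃, E.At i (.mem c (.insert n₁ n₂ n₃))) ∨
    (c.op = .remove ∧ b = true ∧ ∃ n₁ n₂, E.At i (.mem c (.mark n₁ n₂))) ∨
    (c.op = .add ∧ b = false ∧ ∃ n₁ n₂ y, E.At i (.mem c (.check n₁ n₂)) ∧
      (E.st i).heap n₂ = some y ∧ y.val = Val.ofKey c.key) ∨
    (c.op = .remove ∧ b = false ∧ ∃ n₁ n₂ y, E.At i (.mem c (.check n₁ n₂)) ∧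
      (E.st i).heap n₂ = some y ∧ y.val ≠ Val.ofKey c.key) ∨
    (c.op = .contains ∧ b = true ∧ ∃ n x, E.At i (.mem c (.conMark n)) ∧
      (E.st i).heap n = some x ∧ x.marked = false) ∨
    (c.op = .contains ∧ b = false ∧ FailingRead E c i) := by
  obtain ⟨s, s', hA, -, -, hs, h1, h2⟩ := h
  have hf := hA.frameOK
  generalize hh : (E.st i).heap = h at *
  generalize (E.st (i + 1)).heap = h' at *
  cases hs <;> simp only [Instr.outcome, reduceCtorEq, Option.some.injEq] at h1 h2 <;> subst h2
  case check_add_eq n₁ n₂ y hy ho hv =>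
    exact .inr (.inr (.inl ⟨ho, rfl, n₁, n₂, y, hA, hy, hv⟩))
  case check_remove_ne n₁ n₂ y hy ho hv =>
    exact .inr (.inr (.inr (.inl ⟨ho, rfl, n₁, n₂, y, hA, hy, hv⟩)))
  case insert n₁ n₂ n₃ x hx => exact .inl ⟨hf.1, rfl, n₁, n₂, n₃, hA⟩
  case mark n₁ n₂ y hy => exact .inr (.inl ⟨hf.1, rfl, n₁, n₂, hA⟩)
  case conVal_ne n x hx hv =>
    exact .inr (.inr (.inr (.inr (.inr ⟨hf.1, rfl, n, x, by rw [hh, hx], .inl ⟨hA, hv⟩⟩))))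
  case conMark n x hx =>
    cases hm : x.marked
    · exact .inr (.inr (.inr (.inr (.inl ⟨hf.1, by simp, n, x, hA, hx, hm⟩))))
    · exact .inr (.inr (.inr (.inr (.inr ⟨hf.1, by simp, n, x, by rw [hh, hx],
        .inr ⟨hA, hm⟩⟩))))

theorem FailingRead.decides (h : FailingRead E c j) : E.Decides c j false := by
  obtain ⟨n, x, hx, ⟨hA, hv⟩ | ⟨hA, hm⟩⟩ := h <;>
  · refine hA.decides rfl fun s' hs => ?_
    generalize (E.st j).heap = h at *
    generalize (E.st (j + 1)).heap = h' at *
    cases hs <;> simp_all [Instr.outcome]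

theorem Execution.At.decides_insert {n₁ n₂ n₃ : ℕ} (h : E.At i (.mem c (.insert n₁ n₂ n₃))) :
    E.Decides c i true := by
  refine h.decides rfl fun s' hs => ?_
  generalize (E.st i).heap = h at *
  generalize (E.st (i + 1)).heap = h' at *
  cases hs
  rfl

theorem Execution.At.decides_mark {n₁ n₂ : ℕ} (h : E.At i (.mem c (.mark n₁ n₂))) :
    E.Decides c i true := by
  refine h.decides rfl fun s' hs => ?_
  generalize (E.st i).heap = h at *
  generalize (E.st (i + 1)).heap = h' at *
  cases hs
  rfl

/-! ### Evolution of the memory along an execution -/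

theorem Execution.heap_step (E : Execution T) (hi : i < E.len) :
    (E.st (i + 1)).heap = (E.st i).heap ∨
      ∃ c s s', E.At i (.mem c s) ∧ MemStep c (E.st i).heap s (E.st (i + 1)).heap s' := by
  cases he : E.ev i with
  | inv c => exact .inl (Execution.At.inv_step ⟨hi, he⟩).2.2
  | rsp c b => exact .inl (Execution.At.rsp_step ⟨hi, he⟩).2.2
  | mem c s =>
    obtain ⟨-, s', -, hs⟩ := Execution.At.mem_step ⟨hi, he⟩
    exact .inr ⟨c, s, s', ⟨hi, he⟩, hs⟩

theorem Execution.node_evolves (E : Execution T) (hi : i < E.len) {a : ℕ} {x : Node T}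
    (hx : (E.st i).heap a = some x) : ∃ x', (E.st (i + 1)).heap a = some x' ∧ x'.val = x.val ∧
      (x.marked = true → x'.marked = true) := by
  rcases E.heap_step hi with h | ⟨c, s, s', -, hs⟩
  · exact ⟨x, h ▸ hx, rfl, id⟩
  · exact hs.node_evolves hx

theorem Execution.reach_succ (E : Execution T) (hi : i < E.len) {a : ℕ}
    (hr : Reach (E.st i).heap a m)
    (hm : ∃ z, (E.st (i + 1)).heap m = some z ∧ z.marked = false) :
    Reach (E.st (i + 1)).heap a m := by
  rcases E.heap_step hi with h | ⟨c, s, s', hA, hs⟩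
  · rwa [h]
  · exact hs.reach hA.frameOK hr hm

/-- The abstract set changes only at writes of Add and Remove that decide their return value. -/
theorem Execution.decides_of_abs_ne (E : Execution T) (hi : i < E.len)
    (h : (E.st i).abs ≠ (E.st (i + 1)).abs) :
    ∃ c, c.op ≠ .contains ∧ E.Decides c i true := by
  rcases E.heap_step hi with h' | ⟨c, s, s', hA, hs⟩
  · exact absurd (State.abs_congr h').symm h
  · by_cases hins : ∃ n₁ n₂ n₃, s = .insert n₁ n₂ n₃
    · obtain ⟨n₁, n₂, n₃, rfl⟩ := hins
      exact ⟨c, by simp [hA.frameOK.1], hA.decides_insert⟩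
    by_cases hmark : ∃ n₁ n₂, s = .mark n₁ n₂
    · obtain ⟨n₁, n₂, rfl⟩ := hmark
      exact ⟨c, by simp [hA.frameOK.1], hA.decides_mark⟩
    push Not at hins hmark
    exact absurd (hs.abs_eq (E.stateOK hi.le).heap hA.frameOK hins hmark).symm h

/-- This makes the dummy event a correct linearization point for Contains returning `false`. -/
theorem Execution.At.notMem_abs_of_insert {n₁ n₂ n₃ : ℕ}
    (h : E.At i (.mem c (.insert n₁ n₂ n₃))) : c.key ∉ (E.st i).abs := by
  obtain ⟨-, s', -, hs⟩ := h.mem_step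
  exact (hs.abs_insert (E.stateOK h.1.le).heap h.frameOK).1

/-- The event that decides the return value meets the specification, except possibly when
Contains returns `false`. -/
theorem Execution.Decides.spec (h : E.Decides c i b) (hcf : c.op ≠ .contains ∨ b = true) :
    Spec c.op c.key (E.st i).abs b (E.st (i + 1)).abs := by
  rcases h.cases with ⟨ho, rfl, n₁, n₂, n₃, hA⟩ | ⟨ho, rfl, n₁, n₂, hA⟩ |
    ⟨ho, rfl, n₁, n₂, y, hA, hy, hv⟩ | ⟨ho, rfl, n₁, n₂, y, hA, hy, hv⟩ |
    ⟨ho, rfl, n, x, hA, hx, hm⟩ | ⟨ho, rfl, -⟩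
  all_goals rw [ho]
  all_goals try
    have hP := (E.stateOK hA.1.le).heap
    obtain ⟨-, s', -, hs⟩ := hA.mem_step
    have hf := hA.frameOK
  · obtain ⟨h1, h2⟩ := hs.abs_insert hP hf
    rw [h2]
    exact .add_true _ _ h1
  · obtain ⟨h1, h2⟩ := hs.abs_mark hP hf
    rw [h2]
    exact .remove_true _ _ h1
  · rw [hs.abs_eq hP hf (by simp) (by simp)]
    obtain ⟨-, x, y', hw, -, hym, -⟩ := hf
    obtain rfl := hw.eq₂ hy
    exact .add_false _ _ (hP.mem_abs_iff.2 ⟨n₂, hw.mem₂, _, hy, hym, hv⟩)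
  · rw [hs.abs_eq hP hf (by simp) (by simp)]
    obtain ⟨-, x, y', hw, hxm, hym, hn⟩ := hf
    obtain rfl := hw.eq₂ hy
    exact .remove_false _ _ (hw.notMem_abs hP hxm hn hv)
  · rw [hs.abs_eq hP hf (by simp) (by simp)]
    obtain ⟨-, hn, x', hx', hv⟩ := hf
    obtain rfl := Option.some.inj (hx.symm.trans hx')
    -- The traversal proves no reachability at this moment; the invariant supplies it for any linked
    -- unmarked node.
    exact .contains_true _ _ (hP.mem_abs_iff.2 ⟨n, hn, _, hx, hm, hv⟩)
  · simp [ho] at hcf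

/-! ### Contains returning `false` -/

/-- The unmarked node `m` is in the list and has the value `k`, in the state number `n`. -/
def Execution.Present (E : Execution T) (k : ℤ) (m n : ℕ) : Prop :=
  m ∈ E.linked n ∧ ∃ x, (E.st n).heap m = some x ∧ x.marked = false ∧ x.val = Val.ofKey k

/-- Values are fixed and marks are never removed, so backwards in time a present node can cease to
be present only at the `insert` that linked it. -/
theorem Execution.Present.pred {k : ℤ} (h : E.Present k m (n + 1)) (hn : n < E.len)
    (hins : ∀ c n₁ n₂ n₃, E.At n (.mem c (.insert n₁ n₂ n₃)) → c.key ≠ k) :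
    E.Present k m n := by
  obtain ⟨hm, x, hx, hxm, hxv⟩ := h
  have hP := (E.stateOK hn.le).heap
  have hl : m ∈ E.linked n := by
    rcases hm with hm | hm
    · exact hm
    · exfalso
      cases he : E.ev n with
      | inv | rsp => simp [he, Event.published] at hm
      | mem c s =>
        rw [he] at hm
        have hA : E.At n (.mem c s) := ⟨hn, he⟩
        cases s <;> simp [Event.published, Instr.published] at hm
        subst hm
        obtain ⟨-, -, hz, -⟩ := hA.frameOK
        obtain ⟨y, hy, hyv, -⟩ := E.node_evolves hn hz
        obtain rfl := Option.some.inj (hx.symm.trans hy)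
        exact hins _ _ _ _ hA (Val.ofKey_injective (hyv.symm.trans hxv))
  refine ⟨hl, ?_⟩
  obtain ⟨y, hy⟩ := hP.alloc m hl
  obtain ⟨z, hz, hzv, hzm⟩ := E.node_evolves hn hy
  obtain rfl := Option.some.inj (hx.symm.trans hz)
  refine ⟨y, hy, ?_, hzv ▸ hxv⟩
  by_contra hc
  simp [hzm (by simpa using hc)] at hxm

/-- If no Add of the same key takes effect during a Contains call that returns `false`, its key is
absent when the return value is decided. -/
theorem FailingRead.notMem_abs (h : FailingRead E c j) (hadd : ∀ i, ¬ ConcurrentAdd E c j i) :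
    c.key ∉ (E.st j).abs := by
  have hj : j ≤ E.len := by
    obtain ⟨s, s', hA, -⟩ := h.decides
    exact hA.1.le
  intro hk
  obtain ⟨m, hm, x, hx, hxm, hxv⟩ := (E.stateOK hj).heap.mem_abs_iff.1 hk
  obtain ⟨s₀, -, hA, hact, -⟩ := h.decides
  obtain ⟨a, haj, hinv⟩ := hact.exists_inv
  -- Going back `d` events from `j`, down to the state `a + 1` just after the invocation: no
  -- `insert` of this key occurs there, so `m` is present throughout.
  have hpres : ∀ d ≤ j - (a + 1), E.Present c.key m (j - d) := by
    intro d
    induction d with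
    | zero => exact fun _ => ⟨hm, x, hx, hxm, hxv⟩
    | succ d ih =>
      intro hd
      have := ih (by omega)
      rw [show j - d = j - (d + 1) + 1 by omega] at this
      refine this.pred (by omega) fun c' n₁ n₂ n₃ hA' hk' => ?_
      exact hadd _ ⟨⟨a, by omega, hinv⟩, by omega, c', n₁, n₂, n₃, hA', hk'⟩
  -- Forwards from the invocation, the traversal stays before `m`. Presence in state `n` handles the
  -- call's own step; unmarkedness in state `n + 1` keeps the paths to `m`.
  have hbef : ∀ n, a + 1 ≤ n → n ≤ j → ∀ s, E.Active n c s → s.Before (E.st n).heap m := by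
    intro n hn
    induction n, hn using Nat.le_induction with
    | base =>
      intro _ s hs
      have := hinv.inv_step.2.1.2.symm.trans hs.2
      obtain rfl : c.op.entry = s := by grind
      cases c.op <;> trivial
    | succ n hn ih =>
      intro hnj s hs
      have hp := hpres (j - n) (by omega)
      have hp' := hpres (j - (n + 1)) (by omega)
      rw [show j - (j - n) = n by omega] at hp
      rw [show j - (j - (n + 1)) = n + 1 by omega] at hp'
      obtain ⟨hm1, x1, hx1, hxm1, hxv1⟩ := hp
      obtain ⟨-, x2, hx2, hxm2, -⟩ := hp'
      have hstep : ∀ a, Reach (E.st n).heap a m → Reach (E.st (n + 1)).heap a m :=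
        fun a hr => E.reach_succ (by omega) hr ⟨x2, hx2, hxm2⟩
      rcases hs.pred with ⟨h0, -⟩ | ⟨s₀, h0, h1, h2⟩ | ⟨h0, -⟩
      · have := E.inv_unique a hinv.1 n h0.1 c hinv.2 h0.2
        omega
      · exact (h2.before (E.stateOK (by omega)).heap h0.frameOK hm1 hx1 hxm1 hxv1
          (ih (by omega) _ h1)).mono hstep
      · exact (ih (by omega) _ h0).mono hstep
  have hP := (E.stateOK hj).heap
  obtain ⟨n, z, hz, ⟨hA', hv⟩ | ⟨hA', hzm⟩⟩ := h
  · have hr : Reach (E.st j).heap n m := hbef j haj le_rfl _ hA'.mem_step.1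
    obtain ⟨-, hn, z', hz', hge⟩ := hA'.frameOK
    obtain rfl := Option.some.inj (hz.symm.trans hz')
    -- The node read reaches `m` and its value is not below the key, so it is `m`, contradicting the
    -- failed comparison.
    rcases hP.eq_or_lt_of_reach hn hr hz hx with rfl | hlt
    · obtain rfl := Option.some.inj (hz.symm.trans hx)
      exact hv hxv
    · exact hge (hxv ▸ hlt)
  · have hr : n = m := hbef j haj le_rfl _ hA'.mem_step.1
    subst hr
    obtain rfl := Option.some.inj (hz.symm.trans hx)
    simp [hzm] at hxm

/-! ### Existence, uniqueness and correctness of the linearization points -/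

theorem Execution.mem_history_inv : .inv c ∈ E.history ↔ ∃ i, E.At i (.inv c) := by
  simp only [Execution.history, List.mem_filterMap, List.mem_range, Execution.At]
  refine exists_congr fun i => and_congr_right fun _ => ?_
  cases E.ev i <;> simp [Event.toHEvent]

theorem Execution.mem_history_rsp : .rsp c b ∈ E.history ↔ ∃ i, E.At i (.rsp c b) := by
  simp only [Execution.history, List.mem_filterMap, List.mem_range, Execution.At]
  refine exists_congr fun i => and_congr_right fun _ => ?_
  cases E.ev i <;> simp [Event.toHEvent]

/-- When Contains does not return `false`, the linearization point is the deciding event. -/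
theorem Execution.Decides.isLP_iff (h : E.Decides c i b) (hcf : c.op ≠ .contains ∨ b = true) :
    IsLP E c b p ↔ p = .event i := by
  rcases h.cases with ⟨ho, rfl, n₁, n₂, n₃, hA⟩ | ⟨ho, rfl, n₁, n₂, hA⟩ |
    ⟨ho, rfl, n₁, n₂, y, hA, hy, hv⟩ | ⟨ho, rfl, n₁, n₂, y, hA, hy, hv⟩ |
    ⟨ho, rfl, n, x, hA, hx, hm⟩ | ⟨ho, rfl, -⟩
  all_goals simp only [IsLP, ho]
  · refine ⟨?_, fun hp => ⟨i, n₁, n₂, n₃, hA, hp⟩⟩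
    rintro ⟨i', _, _, _, hA', rfl⟩
    rw [hA.eq_of_phase_eq hA' (by simp [Instr.phase]) rfl]
  · refine ⟨?_, fun hp => ⟨i, n₁, n₂, hA, hp⟩⟩
    rintro ⟨i', _, _, hA', rfl⟩
    rw [hA.eq_of_phase_eq hA' (by simp [Instr.phase]) rfl]
  · refine ⟨?_, fun hp => ⟨i, n₁, n₂, hA, hp⟩⟩
    rintro ⟨i', _, _, hA', rfl⟩
    rw [hA.eq_of_phase_eq hA' (by simp [Instr.phase]) rfl]
  · refine ⟨?_, fun hp => ⟨i, n₁, n₂, hA, hp⟩⟩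
    rintro ⟨i', _, _, hA', rfl⟩
    rw [hA.eq_of_phase_eq hA' (by simp [Instr.phase]) rfl]
  · refine ⟨?_, fun hp => ⟨i, n, hA, hp⟩⟩
    rintro ⟨i', _, hA', rfl⟩
    rw [hA.eq_of_phase_eq hA' (by simp [Instr.phase]) rfl]
  · simp [ho] at hcf

theorem Execution.Decides.failingRead (h : E.Decides c i false) (ho : c.op = .contains) :
    FailingRead E c i := by
  rcases h.cases with h | h | h | h | h | h <;> simp_all

theorem ConcurrentAdd.lt (h : ConcurrentAdd E c j i) : i < j := h.2.1

theorem exists_last_concurrentAdd (h : ∃ i, ConcurrentAdd E c j i) :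
    ∃ i, ConcurrentAdd E c j i ∧ ∀ i', ConcurrentAdd E c j i' → i' ≤ i := by
  classical
  obtain ⟨i, hi⟩ := h
  exact ⟨Nat.findGreatest (ConcurrentAdd E c j) j, Nat.findGreatest_spec hi.lt.le hi,
    fun i' hi' => Nat.le_findGreatest hi'.lt.le hi'⟩

/-- A decided call has exactly one linearization point. -/
theorem Execution.Decides.existsUnique_isLP (h : E.Decides c i b) : ∃! p, IsLP E c b p := by
  by_cases hcf : c.op ≠ .contains ∨ b = true
  · exact ⟨.event i, (h.isLP_iff hcf).2 rfl, fun p hp => (h.isLP_iff hcf).1 hp⟩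
  · push Not at hcf
    obtain ⟨ho, hb⟩ := hcf
    obtain rfl : b = false := by simpa using hb
    have hfr := h.failingRead ho
    simp only [IsLP, ho, IsContainsFalseLP]
    have huniq : ∀ j, FailingRead E c j → j = i := fun j hj => (hj.decides.unique h).1
    by_cases hadd : ∃ i', ConcurrentAdd E c i i'
    · obtain ⟨l, hl, hlast⟩ := exists_last_concurrentAdd hadd
      refine ⟨.dummy l, ⟨i, hfr, .inr ⟨l, hl, hlast, rfl⟩⟩, ?_⟩
      rintro p ⟨j, hj, ⟨hno, rfl⟩ | ⟨l', hl', hlast', rfl⟩⟩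
      · exact absurd hl (huniq j hj ▸ hno l)
      · obtain rfl := huniq j hj
        rw [le_antisymm (hlast _ hl') (hlast' _ hl)]
    · push Not at hadd
      refine ⟨.event i, ⟨i, hfr, .inl ⟨hadd, rfl⟩⟩, ?_⟩
      rintro p ⟨j, hj, ⟨hno, rfl⟩ | ⟨l', hl', hlast', rfl⟩⟩
      · rw [huniq j hj]
      · obtain rfl := huniq j hj
        exact absurd hl' (hadd l')

/-- The upper bound is the deciding event rather than the response, so that it also serves pending
calls. -/
theorem Execution.Decides.isLP_bounds (h : E.Decides c i b) (hp : IsLP E c b p) :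
    (∃ a, E.At a (.inv c) ∧ (Point.event a).rank < p.rank) ∧
      p.rank ≤ (Point.event i).rank := by
  obtain ⟨s, s', hA, hact, -⟩ := id h
  obtain ⟨a, hai, ha⟩ := hact.exists_inv
  by_cases hcf : c.op ≠ .contains ∨ b = true
  · obtain rfl := (h.isLP_iff hcf).1 hp
    exact ⟨⟨a, ha, by simp only [Point.rank]; omega⟩, le_rfl⟩
  · push Not at hcf
    obtain ⟨ho, hb⟩ := hcf
    obtain rfl : b = false := by simpa using hb
    simp only [IsLP, ho, IsContainsFalseLP] at hp
    obtain ⟨j, hj, ⟨-, rfl⟩ | ⟨l, ⟨⟨a', ha', hinv⟩, hlj, -⟩, -, rfl⟩⟩ := hp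
    · obtain rfl := (hj.decides.unique h).1
      exact ⟨⟨a, ha, by simp only [Point.rank]; omega⟩, le_rfl⟩
    · obtain rfl := (hj.decides.unique h).1
      -- `a' < l` gives `2 * a' + 1 < 2 * l`: a dummy event just before `l` is still after the
      -- invocation.
      exact ⟨⟨a', hinv, by simp only [Point.rank]; omega⟩, by simp only [Point.rank]; omega⟩

/-- Calls meet the specification at their linearization points. -/
theorem Execution.Decides.spec_isLP (h : E.Decides c i b) (hp : IsLP E c b p) :
    Spec c.op c.key (E.absPre p) b (E.absPost p) := by
  by_cases hcf : c.op ≠ .contains ∨ b = true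
  · obtain rfl := (h.isLP_iff hcf).1 hp
    exact h.spec hcf
  · push Not at hcf
    obtain ⟨ho, hb⟩ := hcf
    obtain rfl : b = false := by simpa using hb
    simp only [IsLP, ho, IsContainsFalseLP] at hp
    rw [ho]
    obtain ⟨j, hj, ⟨hno, rfl⟩ | ⟨l, ⟨-, hlj, c', n₁, n₂, n₃, hA, hk⟩, -, rfl⟩⟩ := hp
    · have hne := hj.notMem_abs hno
      simp only [Execution.absPre, Execution.absPost]
      -- A change would be made by a deciding step of an Add or Remove, but this event belongs to a
      -- Contains.
      have heq : (E.st (j + 1)).abs = (E.st j).abs := by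
        by_contra hc
        obtain ⟨s, s', hA, -⟩ := hj.decides
        obtain ⟨c', ho', hd'⟩ := E.decides_of_abs_ne hA.1 (Ne.symm hc)
        obtain ⟨t, t', hA', -⟩ := id hd'
        obtain rfl : c' = c := by
          have := hA.2.symm.trans hA'.2
          grind
        exact ho' ho
      rw [heq]
      exact .contains_false _ _ hne
    · exact .contains_false _ _ (hk ▸ hA.notMem_abs_of_insert)

/-- Without a response, `IsLP E c true p` alone does not fix the return value: a Contains that reads
a mark has executed the same statement. The change of the abstract set shows that the event is an
`insert` or a `mark`. -/
theorem Execution.isLP_true_decides (hp : IsLP E c true p) (hne : E.absPre p ≠ E.absPost p) :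
    ∃ i, E.Decides c i true ∧ c.op ≠ .contains ∧ p = .event i := by
  have aux : ∀ i s, E.At i (.mem c s) → p = .event i →
      ∃ i, E.Decides c i true ∧ c.op ≠ .contains ∧ p = .event i := by
    rintro i s hA rfl
    obtain ⟨c', ho, hd⟩ := E.decides_of_abs_ne hA.1 hne
    obtain ⟨t, t', hA', -⟩ := id hd
    obtain rfl : c' = c := by
      have := hA.2.symm.trans hA'.2
      grind
    exact ⟨i, hd, ho, rfl⟩
  cases ho : c.op <;> simp only [IsLP, ho] at hp
  · obtain ⟨i, _, _, _, hA, hp⟩ := hp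
    simpa only [ho] using aux i _ hA hp
  · obtain ⟨i, _, _, hA, hp⟩ := hp
    simpa only [ho] using aux i _ hA hp
  · obtain ⟨i, _, hA, hp⟩ := hp
    simpa only [ho] using aux i _ hA hp

theorem Returns.decides (h : Returns E c b) : ∃ i, E.Decides c i b := by
  rcases h with h | ⟨⟨-, p, hp, hne⟩, rfl⟩
  · obtain ⟨r, hr⟩ := Execution.mem_history_rsp.1 h
    obtain ⟨i, -, hd⟩ := hr.rsp_step.1.exists_decides (b := b) rfl
    exact ⟨i, hd⟩
  · obtain ⟨i, hd, -⟩ := Execution.isLP_true_decides hp hne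
    exact ⟨i, hd⟩

theorem Returns.unique (h : Returns E c b) (h' : Returns E c b') : b = b' := by
  obtain ⟨i, hi⟩ := h.decides
  obtain ⟨j, hj⟩ := h'.decides
  exact (hi.unique hj).2

theorem Returns.within (h : Returns E c b) (hp : IsLP E c b p) : Within E c p := by
  obtain ⟨i, hi⟩ := h.decides
  obtain ⟨ha, hle⟩ := hi.isLP_bounds hp
  refine ⟨ha, fun r b' hr => ?_⟩
  have := (hi.rsp hr).1
  simp only [Point.rank] at hle ⊢
  omega

theorem hasLPs (E : Execution T) : HasLPs E := by
  intro c b h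
  obtain ⟨i, hi⟩ := h.decides
  exact ⟨hi.existsUnique_isLP, fun p hp => h.within hp⟩

theorem Returns.spec (h : Returns E c b) (hp : IsLP E c b p) :
    Spec c.op c.key (E.absPre p) b (E.absPost p) := by
  obtain ⟨i, hi⟩ := h.decides
  exact hi.spec_isLP hp

/-- Every change of the abstract set is the linearization point of a call of the completed
history. -/
theorem Execution.exists_returns_of_abs_ne (E : Execution T) (hi : i < E.len)
    (h : (E.st i).abs ≠ (E.st (i + 1)).abs) :
    ∃ c, (∃ s, E.At i (.mem c s)) ∧ Returns E c true ∧ IsLP E c true (.event i) := by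
  obtain ⟨c, ho, hd⟩ := E.decides_of_abs_ne hi h
  obtain ⟨s, s', hA, hact, -⟩ := id hd
  have hlp : IsLP E c true (.event i) := (hd.isLP_iff (.inl ho)).2 rfl
  refine ⟨c, ⟨s, hA⟩, ?_, hlp⟩
  -- Either the call has responded, necessarily with the decided value, or it is pending and this
  -- very change makes it effective.
  by_cases hr : ∃ b, .rsp c b ∈ E.history
  · obtain ⟨b, hb⟩ := hr
    obtain ⟨r, hr⟩ := Execution.mem_history_rsp.1 hb
    obtain ⟨-, rfl⟩ := hd.rsp hr
    exact .inl hb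
  · push Not at hr
    obtain ⟨a, -, ha⟩ := hact.exists_inv
    exact .inr ⟨⟨⟨Execution.mem_history_inv.2 ⟨a, ha⟩, hr⟩, _, hlp, h⟩, rfl⟩

end LazyList

namespace LazyList

universe u

variable {T : Type u} [DecidableEq T]
variable {E : Execution T} {c d : Call T} {s s' : Instr} {i j n m : ℕ} {b b' : Bool} {p q : Point}

/-! ### Specific equivalence -/

/-- Determinism of the specification is what yields Specific Equivalence. -/
theorem Spec.unique {o : Op} {k : ℤ} {A A₁ A₂ : Set ℤ} (h : Spec o k A b A₁)
    (h' : Spec o k A b' A₂) : b = b' ∧ A₁ = A₂ := by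
  cases h <;> cases h' <;> first | exact ⟨rfl, rfl⟩ | contradiction

theorem Sequential.next_eq {T : Type u} {c : Call T} {e : HEvent T} {H₁ H₂ : History T}
    (h : Sequential (H₁ ++ .inv c :: e :: H₂)) : ∃ b, e = .rsp c b := by
  generalize hH : H₁ ++ .inv c :: e :: H₂ = H at h
  induction h generalizing H₁ with
  | nil => simp at hH
  | pending d =>
    have := congrArg List.length hH
    simp at this
    omega
  | cons d b H hs ih =>
    -- A prefix of length one would put an invocation in the place of a response; a longer one loses
    -- its first pair.
    rcases H₁ with _ | ⟨x, _ | ⟨y, H₁⟩⟩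
    · simp only [List.nil_append, List.cons.injEq, HEvent.inv.injEq] at hH
      exact ⟨b, by rw [hH.2.1, hH.1]⟩
    · simp at hH
    · simp only [List.cons_append, List.cons.injEq] at hH
      exact ih hH.2.2

/-- In an execution with a sequential history, the first invocation or response after the
invocation of `c` is the response of `c`. -/
theorem Execution.exists_rsp_of_sequential (hseq : Sequential E.history) (hi : E.At i (.inv c))
    (hij : i < j) (hj : j < E.len) (hne : (E.ev j).toHEvent.isSome) :
    ∃ r b, i < r ∧ r ≤ j ∧ E.At r (.rsp c b) := by
  classical
  have hex : ∃ r, i < r ∧ (E.ev r).toHEvent.isSome := ⟨j, hij, hne⟩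
  obtain ⟨hir, hr⟩ := Nat.find_spec hex
  have hrj : Nat.find hex ≤ j := Nat.find_min' hex ⟨hij, hne⟩
  have hmin : ∀ m < Nat.find hex, i < m → (E.ev m).toHEvent = none := fun m hm him => by
    have := Nat.find_min hex hm
    simpa [him] using this
  generalize Nat.find hex = r at *
  obtain ⟨e, he⟩ := Option.isSome_iff_exists.1 hr
  -- Here `r` is the first history event after `i`; the stretch between them contributes nothing to
  -- the history, so `i` and `r` become adjacent in it.
  have hsplit : List.range E.len = List.range' 0 i ++ i ::
      (List.range' (i + 1) (r - (i + 1)) ++ r :: List.range' (r + 1) (E.len - (r + 1))) := by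
    rw [← List.range'_succ, List.range_eq_range']
    have h1 := List.range'_append_1 (s := i + 1) (m := r - (i + 1)) (n := E.len - (r + 1) + 1)
    rw [show i + 1 + (r - (i + 1)) = r by omega] at h1
    rw [h1, ← List.range'_succ]
    have h2 := List.range'_append_1 (s := 0) (m := i)
      (n := r - (i + 1) + (E.len - (r + 1) + 1) + 1)
    rw [Nat.zero_add] at h2
    rw [h2]
    congr 1
    omega
  have hnil : (List.range' (i + 1) (r - (i + 1))).filterMap (fun m => (E.ev m).toHEvent) = [] := by
    rw [List.filterMap_eq_nil_iff]
    intro m hm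
    rw [List.mem_range'_1] at hm
    exact hmin m (by omega) (by omega)
  rw [Execution.history, hsplit] at hseq
  have hi' : (E.ev i).toHEvent = some (.inv c) := by rw [hi.2]; rfl
  simp only [List.filterMap_append, List.filterMap_cons, hi', he, hnil, List.nil_append] at hseq
  obtain ⟨b, rfl⟩ := hseq.next_eq
  refine ⟨r, b, hir, hrj, by omega, ?_⟩
  cases h : E.ev r <;> simp_all [Event.toHEvent]

/-- In an execution with a sequential history, no other call takes a step between the invocation
and the response of a call. -/
theorem Execution.eq_of_sequential (hseq : Sequential E.history) (hi : E.At i (.inv c))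
    (hj : E.At j (.rsp c b)) (hin : i ≤ n) (hnj : n ≤ j) (hn : E.At n (.mem d s)) : d = c := by
  obtain ⟨hact, -⟩ := hn.mem_step
  obtain ⟨a, han, ha⟩ := hact.exists_inv
  -- If `d` was invoked earlier, it responded before `i`; if later, `c` responded before that.
  -- Neither is compatible with a step of `d` at `n`.
  rcases lt_trichotomy a i with h | rfl | h
  · obtain ⟨r, b', har, hri, hr⟩ := E.exists_rsp_of_sequential hseq ha h hi.1
      (by simp [hi.2, Event.toHEvent])
    have := hact.lt_rsp hr
    obtain rfl : r = i := by omega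
    have := hr.2.symm.trans hi.2
    simp at this
  · have := ha.2.symm.trans hi.2
    grind
  · obtain ⟨r, b', hir, hra, hr⟩ := E.exists_rsp_of_sequential hseq hi h ha.1
      (by simp [ha.2, Event.toHEvent])
    have := (hj.rsp_unique hr).1
    omega

theorem Execution.abs_eq_of_forall (E : Execution T) (hij : i ≤ j)
    (h : ∀ n, i ≤ n → n < j → (E.st n).abs = (E.st (n + 1)).abs) :
    (E.st i).abs = (E.st j).abs := by
  induction j, hij using Nat.le_induction with
  | base => rfl
  | succ j hj ih =>
    rw [ih fun n hn hnj => h n hn (by omega)]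
    exact h j hj (Nat.lt_succ_self j)

/-- The calls in `E` and `F` both meet `Spec` from the same set. In `F` the sets around the
linearization point are those at the invocation and after the response. -/
theorem specificEquivalence (E F : Execution T) (hF : Sequential F.history) :
    SpecificEquivalence E F := by
  intro c b p hc hp c' b' i j hi hj hop hkey habs
  have hc' : Returns F c' b' := .inl (Execution.mem_history_rsp.2 ⟨j, hj⟩)
  obtain ⟨q, hq, huniq⟩ := (hasLPs F c' b' hc').1
  -- Any change is the linearization point of the call executing it, and between `i` and `j` that
  -- call can only be `c'`, whose unique point is `q`.
  have hch : ∀ n, i ≤ n → n ≤ j → q ≠ .event n → (F.st n).abs = (F.st (n + 1)).abs := by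
    intro n hin hnj hne
    by_contra hcon
    have hjl := hj.1
    obtain ⟨d, ⟨s, hd⟩, hret, hlp⟩ := F.exists_returns_of_abs_ne (by omega) hcon
    obtain rfl := F.eq_of_sequential hF hi hj hin hnj hd
    obtain rfl := hc'.unique hret
    exact hne (huniq _ hlp).symm
  obtain ⟨⟨a, ha, haq⟩, hqj⟩ := hc'.within hq
  obtain rfl := F.inv_unique a ha.1 i hi.1 c' ha.2 hi.2
  have hqj := hqj j b' hj
  have hends : F.absPre q = (F.st a).abs ∧ F.absPost q = (F.st (j + 1)).abs := by
    cases q with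
    | event l =>
      simp only [Point.rank] at haq hqj
      constructor
      · exact (F.abs_eq_of_forall (by omega) fun n h1 h2 =>
          hch n h1 (by omega) (by simp; omega)).symm
      · exact F.abs_eq_of_forall (by omega) fun n h1 h2 =>
          hch n (by omega) (by omega) (by simp; omega)
    | dummy l =>
      simp only [Point.rank] at haq hqj
      constructor
      · exact (F.abs_eq_of_forall (by omega) fun n h1 h2 =>
          hch n h1 (by omega) (by simp)).symm
      · exact F.abs_eq_of_forall (by omega) fun n h1 h2 =>
          hch n (by omega) (by omega) (by simp)
  have h1 := hc.spec hp
  have h2 := hc'.spec hq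
  rw [hends.1, hends.2] at h2
  rw [habs, hop, hkey] at h1
  exact h1.unique h2

/-! ### The linearization -/

theorem Point.rank_event (i : ℕ) : (Point.event i).rank = 2 * i + 1 := rfl

theorem Point.rank_injective : Function.Injective Point.rank := by
  rintro (i | i) (j | j) h <;> simp only [Point.rank] at h <;> grind

/-! ### Sequential histories built from lists of calls. -/

/-- The invocations and responses of a list of calls with their return values, as a sequential
history. -/
def sequentialHistory {T : Type u} (L : List (Call T × Bool)) : History T :=
  L.flatMap fun x => [.inv x.1, .rsp x.1 x.2]

section sequentialHistory

variable {T : Type u} {L L' : List (Call T × Bool)} {c : Call T}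

theorem sequentialHistory_cons (x : Call T × Bool) (L : List (Call T × Bool)) :
    sequentialHistory (x :: L) = .inv x.1 :: .rsp x.1 x.2 :: sequentialHistory L := rfl

theorem sequentialHistory_append :
    sequentialHistory (L ++ L') = sequentialHistory L ++ sequentialHistory L' :=
  List.flatMap_append

theorem sequential_sequentialHistory : Sequential (sequentialHistory L) := by
  induction L with
  | nil => exact .nil
  | cons x L ih => exact .cons _ _ _ ih

theorem inv_mem_sequentialHistory : .inv c ∈ sequentialHistory L ↔ ∃ b, (c, b) ∈ L := by
  simp only [sequentialHistory, List.mem_flatMap, List.mem_cons, HEvent.inv.injEq, reduceCtorEq,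
    List.not_mem_nil, or_false, Prod.exists]
  grind

theorem rsp_mem_sequentialHistory : .rsp c b ∈ sequentialHistory L ↔ (c, b) ∈ L := by
  simp only [sequentialHistory, List.mem_flatMap, List.mem_cons, HEvent.rsp.injEq, reduceCtorEq,
    List.not_mem_nil, or_false, false_or, Prod.exists]
  grind

theorem nodup_sequentialHistory (h : (L.map Prod.fst).Nodup) : (sequentialHistory L).Nodup := by
  induction L with
  | nil => exact List.nodup_nil
  | cons x L ih =>
    rw [List.map_cons, List.nodup_cons] at h
    have hx : ∀ b, (x.1, b) ∉ L := fun b hb => h.1 (List.mem_map.2 ⟨_, hb, rfl⟩)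
    rw [sequentialHistory_cons, List.nodup_cons, List.nodup_cons, List.mem_cons,
      inv_mem_sequentialHistory, rsp_mem_sequentialHistory]
    exact ⟨by simpa using hx, hx _, ih h.2⟩

theorem pairwise_sequentialHistory {r : Call T → Call T → Prop} (hr : ∀ c, r c c)
    (h : L.Pairwise fun x y => r x.1 y.1) :
    (sequentialHistory L).Pairwise fun e e' => r e.call e'.call := by
  induction L with
  | nil => exact List.Pairwise.nil
  | cons x L ih =>
    rw [List.pairwise_cons] at h
    have hx : ∀ e ∈ sequentialHistory L, r x.1 e.call := by
      intro e he
      cases e with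
      | inv d =>
        obtain ⟨b, hb⟩ := inv_mem_sequentialHistory.1 he
        exact h.1 _ hb
      | rsp d b => exact h.1 _ (rsp_mem_sequentialHistory.1 he)
    rw [sequentialHistory_cons, List.pairwise_cons, List.pairwise_cons]
    refine ⟨?_, hx, ih h.2⟩
    intro e he
    rcases List.mem_cons.1 he with rfl | he
    · exact hr _
    · exact hx e he

/-- For the calls sharing a rank at which the abstract set does not change: they are legal in any
order. -/
theorem LegalFrom.append_of_spec {A : Set ℤ} {H : History T} (hH : LegalFrom A H)
    (hL : ∀ x ∈ L, Spec x.1.op x.1.key A x.2 A) : LegalFrom A (sequentialHistory L ++ H) := by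
  induction L with
  | nil => exact hH
  | cons x L ih =>
    exact .cons A A x.1 x.2 _ (hL x (by simp)) (ih fun y hy => hL y (by simp [hy]))

end sequentialHistory

/-! ### Order of events in a history, and ranks of linearization points. -/

/-- The events of the history are in the order of the execution. -/
theorem Execution.pairwise_history (E : Execution T) :
    E.history.Pairwise fun e e' => ∃ i j, i < j ∧ j < E.len ∧
      (E.ev i).toHEvent = some e ∧ (E.ev j).toHEvent = some e' := by
  rw [Execution.history, List.pairwise_filterMap]
  refine List.pairwise_lt_range.imp_of_mem ?_
  intro i j _ hj hij e he e' he'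
  exact ⟨i, j, hij, List.mem_range.1 hj, he, he'⟩

theorem Event.toHEvent_eq_inv {T : Type u} {e : Event T} {c : Call T} :
    e.toHEvent = some (.inv c) ↔ e = .inv c := by
  cases e <;> simp [Event.toHEvent]

theorem Event.toHEvent_eq_rsp {T : Type u} {e : Event T} {c : Call T} {b : Bool} :
    e.toHEvent = some (.rsp c b) ↔ e = .rsp c b := by
  cases e <;> simp [Event.toHEvent]

theorem Execution.nodup_history (E : Execution T) : E.history.Nodup := by
  refine E.pairwise_history.imp ?_
  rintro e _ ⟨i, j, hij, hj, hi', hj'⟩ rfl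
  cases e with
  | inv c =>
    rw [Event.toHEvent_eq_inv] at hi' hj'
    have := E.inv_unique i (by omega) j hj c hi' hj'
    omega
  | rsp c b =>
    rw [Event.toHEvent_eq_rsp] at hi' hj'
    have := (Execution.At.rsp_unique ⟨by omega, hi'⟩ ⟨hj, hj'⟩).1
    omega

theorem Execution.exists_of_realTime (h : RealTime E.history c d) :
    ∃ i j b, i < j ∧ E.At i (.rsp c b) ∧ E.At j (.inv d) := by
  obtain ⟨i, j, b, hij, hi, hj⟩ := h
  obtain ⟨hi1, hi⟩ := List.getElem?_eq_some_iff.1 hi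
  obtain ⟨hj1, hj⟩ := List.getElem?_eq_some_iff.1 hj
  obtain ⟨i', j', hij', hj', h1, h2⟩ := List.pairwise_iff_getElem.1 E.pairwise_history i j hi1 hj1 hij
  rw [hi, Event.toHEvent_eq_rsp] at h1
  rw [hj, Event.toHEvent_eq_inv] at h2
  exact ⟨i', j', b, hij', ⟨by omega, h1⟩, ⟨hj', h2⟩⟩

open Classical in
/-- The position of the linearization point of a call of the completed history. -/
noncomputable def Execution.lpRank (E : Execution T) (c : Call T) : ℕ :=
  -- Only calls of the completed history are ever compared, so the default `0` plays no role.
  if h : ∃ p b, Returns E c b ∧ IsLP E c b p then h.choose.rank else 0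

theorem Returns.lpRank_eq (h : Returns E c b) (hp : IsLP E c b p) : E.lpRank c = p.rank := by
  have hex : ∃ p b, Returns E c b ∧ IsLP E c b p := ⟨p, b, h, hp⟩
  rw [Execution.lpRank, dif_pos hex]
  obtain ⟨b', hb', hp'⟩ := hex.choose_spec
  obtain rfl := h.unique hb'
  rw [(hasLPs E c b h).1.unique hp hp']

theorem Returns.exists_isLP (h : Returns E c b) : ∃ p, IsLP E c b p ∧ E.lpRank c = p.rank := by
  obtain ⟨p, hp, -⟩ := (hasLPs E c b h).1
  exact ⟨p, hp, h.lpRank_eq hp⟩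

/-- An event belongs to a single call, so two calls linearized at the same event coincide; only
dummy points can be shared. -/
theorem Returns.exists_at_of_isLP (h : Returns E c b) (hp : IsLP E c b (.event i)) :
    ∃ s, E.At i (.mem c s) := by
  obtain ⟨l, hl⟩ := h.decides
  obtain ⟨s, s', hA, -⟩ := id hl
  by_cases hcf : c.op ≠ .contains ∨ b = true
  · obtain ⟨rfl⟩ := (hl.isLP_iff hcf).1 hp
    exact ⟨s, hA⟩
  · push Not at hcf
    obtain ⟨ho, hb⟩ := hcf
    obtain rfl : b = false := by simpa using hb
    simp only [IsLP, ho, IsContainsFalseLP] at hp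
    obtain ⟨j, hj, ⟨-, hp⟩ | ⟨l, -, -, hp⟩⟩ := hp
    · obtain ⟨rfl⟩ := hp
      obtain ⟨t, t', hA', -⟩ := hj.decides
      exact ⟨t, hA'⟩
    · simp at hp

theorem Returns.lpRank_lt (h : Returns E c b) : E.lpRank c < 2 * E.len := by
  obtain ⟨p, hp, hr⟩ := h.exists_isLP
  obtain ⟨i, hi⟩ := h.decides
  have hle := (hi.isLP_bounds hp).2
  obtain ⟨s, s', hA, -⟩ := hi
  have := hA.1
  rw [Point.rank_event] at hle
  omega

theorem Returns.exists_inv (h : Returns E c b) : ∃ a, E.At a (.inv c) := by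
  obtain ⟨i, s, s', -, hact, -⟩ := h.decides
  obtain ⟨a, -, ha⟩ := hact.exists_inv
  exact ⟨a, ha⟩

theorem Execution.exists_list_returns (E : Execution T) :
    ∃ L : List (Call T × Bool), L.Nodup ∧ ∀ x, x ∈ L ↔ Returns E x.1 x.2 := by
  classical
  have hfin : {x : Call T × Bool | Returns E x.1 x.2}.Finite := by
    have h1 : {c : Call T | .inv c ∈ E.history}.Finite := by
      refine Set.Finite.preimage (f := HEvent.inv) ?_ (List.finite_toSet E.history)
      intro a _ b _ hab
      simpa using hab
    refine (h1.prod (Set.finite_univ (α := Bool))).subset ?_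
    intro x hx
    exact ⟨Execution.mem_history_inv.2 (Returns.exists_inv hx), trivial⟩
  exact ⟨hfin.toFinset.toList, Finset.nodup_toList _, by simp⟩

theorem Execution.abs_zero (E : Execution T) : (E.st 0).abs = ∅ := by
  rw [E.st_zero]
  ext k
  rw [StateOK.start.heap.mem_abs_iff]
  simp only [Set.mem_empty_iff_false, iff_false]
  rintro ⟨a, rfl | rfl, x, hx, -, hv⟩
  · obtain rfl : (⟨⊥, some tail, false, none⟩ : Node T) = x := by
      simpa [State.start, initialHeap] using hx
    exact (Val.bot_lt_ofKey k).ne hv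
  · obtain rfl : (⟨⊤, none, false, none⟩ : Node T) = x := by
      simpa [State.start, initialHeap, head, tail] using hx
    exact (Val.ofKey_lt_top k).ne' hv

/-! ### The completed calls sorted by linearization point. -/

open Classical in
/-- The calls of `L` in the order of their linearization points, from the position `r` on. -/
noncomputable def Execution.byRank (E : Execution T) (L : List (Call T × Bool)) (r k : ℕ) :
    List (Call T × Bool) :=
  (List.range' r k).flatMap fun r => L.filter fun x => E.lpRank x.1 = r

section byRank

variable {L : List (Call T × Bool)}

/-- Ranks `2 * n` (dummy) and `2 * n + 1` (event) both start from state `n`, and the next rank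
starts from state `n + 1`; hence `r / 2`. The induction prepends the calls of rank `r` to the legal
history of the later ranks. -/
theorem Execution.legalFrom_byRank (hL : L.Nodup) (hret : ∀ x, x ∈ L ↔ Returns E x.1 x.2)
    (r k : ℕ) (hrk : r + k = 2 * E.len) :
    LegalFrom (E.st (r / 2)).abs (sequentialHistory (E.byRank L r k)) := by
  classical
  induction k generalizing r with
  | zero => exact .nil _
  | succ k ih =>
    have ih := ih (r + 1) (by omega)
    rw [Execution.byRank, List.range'_succ, List.flatMap_cons, sequentialHistory_append]
    rw [Execution.byRank] at ih
    generalize (List.range' (r + 1) k).flatMap _ = L' at ih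
    have hmem : ∀ x, x ∈ L.filter (fun x => E.lpRank x.1 = r) ↔
        Returns E x.1 x.2 ∧ ∃ p, IsLP E x.1 x.2 p ∧ p.rank = r := by
      intro x
      rw [List.mem_filter, hret, decide_eq_true_eq]
      refine and_congr_right fun hx => ⟨fun h => ?_, ?_⟩
      · obtain ⟨p, hp, hpr⟩ := hx.exists_isLP
        exact ⟨p, hp, hpr ▸ h⟩
      · rintro ⟨p, hp, hpr⟩
        rw [hx.lpRank_eq hp, hpr]
    have hnd : (L.filter (fun x => E.lpRank x.1 = r)).Nodup := hL.filter _
    generalize L.filter (fun x => E.lpRank x.1 = r) = B at hmem hnd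
    obtain ⟨n, rfl | rfl⟩ : ∃ n, r = 2 * n ∨ r = 2 * n + 1 := ⟨r / 2, by omega⟩
    · rw [show (2 * n + 1) / 2 = n by omega] at ih
      rw [show 2 * n / 2 = n by omega]
      refine ih.append_of_spec fun x hx => ?_
      obtain ⟨hx, p, hp, hpr⟩ := (hmem x).1 hx
      obtain rfl : p = .dummy n := Point.rank_injective hpr
      exact hx.spec hp
    · rw [show (2 * n + 1 + 1) / 2 = n + 1 by omega] at ih
      rw [show (2 * n + 1) / 2 = n by omega]
      have hB : ∀ x ∈ B, Returns E x.1 x.2 ∧ IsLP E x.1 x.2 (.event n) := by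
        intro x hx
        obtain ⟨hx, p, hp, hpr⟩ := (hmem x).1 hx
        obtain rfl : p = .event n := Point.rank_injective hpr
        exact ⟨hx, hp⟩
      -- If the event leaves the set unchanged, its calls can simply be prepended. Otherwise its
      -- block must be shown to consist of exactly the call that makes the change.
      by_cases habs : (E.st n).abs = (E.st (n + 1)).abs
      · rw [← habs] at ih
        refine ih.append_of_spec fun x hx => ?_
        have := (hB x hx).1.spec (hB x hx).2
        simpa only [Execution.absPre, Execution.absPost, ← habs] using this
      · obtain ⟨c, ⟨s, hc⟩, hr, hlp⟩ := E.exists_returns_of_abs_ne (by omega) habs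
        have hcB : (c, true) ∈ B := (hmem _).2 ⟨hr, _, hlp, rfl⟩
        have hall : ∀ x ∈ B, x = (c, true) := by
          rintro ⟨d, b⟩ hx
          obtain ⟨s', hd⟩ := (hB _ hx).1.exists_at_of_isLP (hB _ hx).2
          obtain rfl : d = c := by
            have := hc.2.symm.trans hd.2
            grind
          have hb : b = true := (hB _ hx).1.unique hr
          rw [hb]
        have hsing : B = [(c, true)] := by
          rcases B with _ | ⟨x, _ | ⟨y, B⟩⟩
          · simp at hcB
          · rw [hall x (by simp)]
          · rw [hall x (by simp), hall y (by simp)] at hnd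
            simp at hnd
        rw [hsing]
        exact .cons _ _ _ _ _ (hr.spec hlp) ih

theorem Execution.mem_byRank (hret : ∀ x, x ∈ L ↔ Returns E x.1 x.2) (x : Call T × Bool) :
    x ∈ E.byRank L 0 (2 * E.len) ↔ Returns E x.1 x.2 := by
  simp only [Execution.byRank, List.mem_flatMap, List.mem_range'_1, List.mem_filter, hret,
    decide_eq_true_eq]
  constructor
  · rintro ⟨r, -, h, -⟩
    exact h
  · intro h
    have := h.lpRank_lt
    exact ⟨_, by omega, h, rfl⟩

theorem Execution.pairwise_byRank (E : Execution T) (L : List (Call T × Bool)) (r k : ℕ) :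
    (E.byRank L r k).Pairwise fun x y => E.lpRank x.1 ≤ E.lpRank y.1 := by
  rw [Execution.byRank, List.pairwise_flatMap]
  constructor
  · intro r _
    refine List.pairwise_iff_forall_sublist.2 fun {x y} hxy => ?_
    have hx := hxy.subset (List.mem_cons_self)
    have hy := hxy.subset (List.mem_cons_of_mem _ List.mem_cons_self)
    simp only [List.mem_filter, decide_eq_true_eq] at hx hy
    omega
  · refine List.Pairwise.imp ?_ List.pairwise_lt_range'
    intro i j hij x hx y hy
    simp only [List.mem_filter, decide_eq_true_eq] at hx hy
    omega

theorem Execution.nodup_byRank (E : Execution T) (hL : L.Nodup) (r k : ℕ) :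
    (E.byRank L r k).Nodup := by
  rw [Execution.byRank, List.nodup_flatMap]
  refine ⟨fun r _ => hL.filter _, List.Pairwise.imp ?_ List.pairwise_lt_range'⟩
  intro i j hij x hx hy
  simp only [List.mem_filter, decide_eq_true_eq] at hx hy
  omega

end byRank

/-- The linearization lists all completed calls by rank. Filtering that list for the pending
effective calls gives `R`, already in the required order. -/
theorem linearizedByLPs (E : Execution T) : LinearizedByLPs E := by
  classical
  obtain ⟨L₀, hL₀, hret⟩ := E.exists_list_returns
  have hmem := Execution.mem_byRank hret
  have hsorted := E.pairwise_byRank L₀ 0 (2 * E.len)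
  have hnodup := E.nodup_byRank hL₀ 0 (2 * E.len)
  have hlegal := Execution.legalFrom_byRank hL₀ hret 0 (2 * E.len) (by omega)
  generalize E.byRank L₀ 0 (2 * E.len) = L at hmem hsorted hnodup hlegal
  rw [Nat.zero_div, E.abs_zero] at hlegal
  have hinj : ∀ x ∈ L, ∀ y ∈ L, x.1 = y.1 → x = y := by
    intro x hx y hy hxy
    have h1 := (hmem x).1 hx
    rw [hxy] at h1
    exact Prod.ext hxy (h1.unique ((hmem y).1 hy))
  have hnodup' : (L.map Prod.fst).Nodup :=
    (List.nodup_map_iff_inj_on hnodup).2 hinj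
  have hRmem : ∀ c b, (c, b) ∈ L.filter (fun x => PendingEffective E x.1) ↔
      PendingEffective E c ∧ b = true := by
    intro c b
    rw [List.mem_filter, hmem, decide_eq_true_eq]
    constructor
    · rintro ⟨h1, h2⟩
      exact ⟨h2, h1.unique (.inr ⟨h2, rfl⟩)⟩
    · rintro ⟨h1, rfl⟩
      exact ⟨.inr ⟨h1, rfl⟩, h1⟩
  have hRsub : (L.filter (fun x => PendingEffective E x.1)).Sublist L := List.filter_sublist
  generalize L.filter (fun x => PendingEffective E x.1) = R at hRmem hRsub
  have hRnd : (R.map Prod.fst).Nodup := hnodup'.sublist (hRsub.map _)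
  have hRfst : ∀ c, c ∈ R.map Prod.fst ↔ PendingEffective E c := by
    intro c
    simp [hRmem]
  have hinvH' : ∀ c, .inv c ∈ E.history.completeBy R ↔ ∃ b, Returns E c b := by
    intro c
    simp only [History.completeBy, List.mem_append, List.mem_filter, List.mem_map, reduceCtorEq,
      and_false, exists_false, or_false, decide_eq_true_eq, HEvent.call]
    rw [← List.mem_map, hRfst]
    constructor
    · rintro ⟨hc, hp | hp⟩
      · simp only [Pending, hc, true_and, not_forall, not_not] at hp
        obtain ⟨b, hb⟩ := hp
        exact ⟨b, .inl hb⟩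
      · exact ⟨true, .inr ⟨hp, rfl⟩⟩
    · rintro ⟨b, hb⟩
      refine ⟨Execution.mem_history_inv.2 hb.exists_inv, ?_⟩
      rcases hb with hb | hb
      · exact .inl fun hp => hp.2 b hb
      · exact .inr hb.1
  have hrspH' : ∀ c b, .rsp c b ∈ E.history.completeBy R ↔ Returns E c b := by
    intro c b
    simp only [History.completeBy, List.mem_append, List.mem_filter, List.mem_map,
      decide_eq_true_eq, HEvent.call, HEvent.rsp.injEq, Prod.exists, exists_eq_right_right,
      exists_eq_right, hRmem, Returns]
    refine or_congr_left ⟨fun h => h.1, fun h => ⟨h, .inl fun hp => hp.2 b h⟩⟩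
  -- Neither side has repetitions, so it is enough to compare members.
  have hperm : (sequentialHistory L).Perm (E.history.completeBy R) := by
    refine (List.perm_ext_iff_of_nodup (nodup_sequentialHistory hnodup') ?_).2 ?_
    · rw [History.completeBy, List.nodup_append]
      refine ⟨E.nodup_history.filter _, ?_, ?_⟩
      · refine (hRnd.of_map _).map ?_
        rintro ⟨c, b⟩ ⟨c', b'⟩ h
        simpa using h
      · rintro e he _ he' rfl
        obtain ⟨⟨c, b⟩, hx, rfl⟩ := List.mem_map.1 he'
        exact ((hRmem c b).1 hx).1.1.2 b (List.mem_filter.1 he).1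
    · rintro (c | ⟨c, b⟩)
      · rw [inv_mem_sequentialHistory, hinvH']
        exact exists_congr fun b => hmem (c, b)
      · rw [rsp_mem_sequentialHistory, hrspH']
        exact hmem (c, b)
  have hS := pairwise_sequentialHistory (r := fun c d => E.lpRank c ≤ E.lpRank d)
    (fun _ => le_rfl) hsorted
  refine ⟨R, sequentialHistory L, ⟨⟨R, hRnd, ?_, rfl⟩, sequential_sequentialHistory, hperm, ?_,
    hlegal⟩, hRnd, hRmem, ?_, ?_⟩
  · intro x hx
    exact ((hRmem x.1 x.2).1 hx).1.1
  · intro c d hc hd hrt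
    obtain ⟨i, j, b, hij, hi, hj⟩ := Execution.exists_of_realTime hrt
    have hcb : Returns E c b := .inl (Execution.mem_history_rsp.2 ⟨i, hi⟩)
    obtain ⟨b', hdb⟩ := (hinvH' d).1 hd
    obtain ⟨p, hp, hpr⟩ := hcb.exists_isLP
    obtain ⟨q, hq, hqr⟩ := hdb.exists_isLP
    have hp1 := (hcb.within hp).2 i b hi
    obtain ⟨⟨a, ha, hq1⟩, -⟩ := hdb.within hq
    obtain rfl := E.inv_unique a ha.1 j hj.1 d ha.2 hj.2
    -- The point of `c` precedes its response, which precedes the invocation of `d`, which precedes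
    -- the point of `d`. As `S` is sorted by rank, `c` cannot come after `d`.
    rw [Point.rank_event] at hp1 hq1
    obtain ⟨m, hm, hm'⟩ := List.getElem_of_mem (rsp_mem_sequentialHistory.2 ((hmem (c, b)).2 hcb))
    obtain ⟨n, hn, hn'⟩ :=
      List.getElem_of_mem (inv_mem_sequentialHistory.2 ⟨b', (hmem (d, b')).2 hdb⟩)
    refine ⟨m, n, b, ?_, List.getElem?_eq_some_iff.2 ⟨hm, hm'⟩,
      List.getElem?_eq_some_iff.2 ⟨hn, hn'⟩⟩
    rcases lt_trichotomy m n with h | rfl | h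
    · exact h
    · simp [hm'] at hn'
    · have := List.pairwise_iff_getElem.1 hS n m hn hm h
      simp only [hm', hn', HEvent.call] at this
      omega
  · refine List.Pairwise.imp_of_mem ?_
      ((hsorted.sublist hRsub).and (hRnd.of_map _))
    rintro x y hx hy ⟨hle, hne⟩ p q hp hq
    have hxr := (hmem x).1 (hRsub.subset hx)
    have hyr := (hmem y).1 (hRsub.subset hy)
    rw [hxr.lpRank_eq hp, hyr.lpRank_eq hq] at hle
    -- Equal ranks mean equal points. An effective call has its point at a real event, which belongs
    -- to one call only, so equality would force `x = y`.
    refine lt_of_le_of_ne hle fun heq => hne ?_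
    obtain rfl := Point.rank_injective heq
    have hxt := ((hRmem x.1 x.2).1 hx)
    obtain ⟨⟨-, p', hp', hne'⟩, hxb⟩ := hxt
    obtain ⟨i, hd, ho, hpi⟩ := Execution.isLP_true_decides hp' hne'
    rw [hxb] at hp
    obtain rfl := (hd.isLP_iff (.inl ho)).1 hp
    obtain ⟨s, hs⟩ := hxr.exists_at_of_isLP (by rw [hxb]; exact hp)
    obtain ⟨s', hs'⟩ := hyr.exists_at_of_isLP hq
    refine hinj x (hRsub.subset hx) y (hRsub.subset hy) ?_
    have := hs.2.symm.trans hs'.2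
    grind
  · intro c b p c' b' p' hc hc' hp hp' ⟨m, n, b₁, hmn, hm, hn⟩
    have h1 := (hmem _).1 (rsp_mem_sequentialHistory.1 hc)
    have h2 := (hmem _).1 (rsp_mem_sequentialHistory.1 hc')
    obtain ⟨hm1, hm⟩ := List.getElem?_eq_some_iff.1 hm
    obtain ⟨hn1, hn⟩ := List.getElem?_eq_some_iff.1 hn
    have := List.pairwise_iff_getElem.1 hS m n hm1 hn1 hmn
    simp only [hm, hn, HEvent.call] at this
    rwa [h1.lpRank_eq hp, h2.lpRank_eq hp'] at this

end LazyList

theorem mainTheorem2 {T : Type*} [DecidableEq T] (E : LazyList.Execution T) :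
    LazyList.HasLPs E ∧
    (∀ F : LazyList.Execution T,
      LazyList.Sequential F.history → LazyList.SpecificEquivalence E F) ∧
    LazyList.Linearizable E.history ∧
    LazyList.LinearizedByLPs E := by
  have hlin := LazyList.linearizedByLPs E
  obtain ⟨R, S, hS, -⟩ := id hlin
  exact ⟨LazyList.hasLPs E, fun F hF => LazyList.specificEquivalence E F hF, ⟨_, S, hS⟩, hlin⟩
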